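/- For a finite set $S\subset\mathbb{Z}^2$ of $n$ lattice points, call $S$ digital convex if $\mathrm{conv}(S)\cap\mathbb{Z}^2=S$. Consider the following algorithm isDigitalConvex, whose input is $S$, given as a list of the coordinates of its points in arbitrary order, without repetition. (The empty set is accepted.) (1) Initialization. Take the top-most and the bottom-most point of $S$ as the two vertices of a (degenerate) partial hull, and insert in it the points of $S$ that are extreme in the two directions normal to the line through them. Only the points of $S$ strictly outside the partial hull remain. (2) While points remain, run one step of QuickHull: for every edge $ab$ of the partial hull that has remaining points strictly outside of it, find the remaining points farthest from $ab$ on its outer side, insert the first and the last of them along $ab$ as vertices between $a$ and $b$, and discard all remaining points that are not strictly outside the new partial hull. If the step discards fewer than half of the points that remained before it, answer "false" and stop. (3) When no point remains, the partial hull is $\mathrm{conv}(S)$. Compute $|\mathrm{conv}(S)\cap\mathbb{Z}^2|$ by Pick's formula $A+B/2+1$, where $A$ is the area and $B$ is the number of boundary lattice points, obtained as a sum over the edges of greatest common divisors computed by Euclid's algorithm. Answer "false" if $|\mathrm{conv}(S)\cap\mathbb{Z}^2|>|S|$ and "true" otherwise. Then for every finite $S\subset\mathbb{Z}^2$ the algorithm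 answers "true" if and only if $S$ is digital convex. Moreover, there is an absolute constant $C$ such that for every nonempty $S$ it performs at most $C\,(n+h\log r)$ elementary operations, where $h$ is the number of edges of $\mathrm{conv}(S)$ and $r$ is the Euclidean diameter of $S$ (with $h\log r$ read as $0$ if $S$ is a single point). Elementary operations are arithmetic operations (including division with remainder) and comparisons on integers, and elementary list operations, each at unit cost. -/

import Mathlib

namespace DigitalConvexity

/-! ### Digital convexity, the number of edges and the diameter of a lattice set -/

/-- A point of the lattice `ℤ²`, given by its coordinates. -/
abbrev Pt : Type := ℤ × ℤ

/-- The inclusion of `ℤ²` in the Euclidean plane. -/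
noncomputable def toPlane (p : Pt) : EuclideanSpace ℝ (Fin 2) := !₂[(p.1 : ℝ), (p.2 : ℝ)]

/-- The convex hull `conv(S)` in the Euclidean plane of a set of lattice points. -/
noncomputable def conv (S : Set Pt) : Set (EuclideanSpace ℝ (Fin 2)) :=
  convexHull ℝ (toPlane '' S)

/-- `S` is digital convex if `conv(S) ∩ ℤ² = S`. -/
def DigitalConvex (S : Set Pt) : Prop :=
  conv S ∩ Set.range toPlane = toPlane '' S

/-- The set of edges of a convex set `K` of the plane: its faces (subsets on which some linear
form attains its maximum over `K`) that are nondegenerate segments. -/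
def edges (K : Set (EuclideanSpace ℝ (Fin 2))) : Set (Set (EuclideanSpace ℝ (Fin 2))) :=
  {F | IsExposed ℝ K F ∧ ∃ a b, a ≠ b ∧ F = segment ℝ a b}

/-- The number of edges of `conv(S)`. -/
noncomputable def numEdges (S : Set Pt) : ℕ := (edges (conv S)).ncard

/-- The (Euclidean) diameter of `S`. -/
noncomputable def diameter (S : Set Pt) : ℝ := Metric.diam (toPlane '' S)

/-! ### Cost model

Algorithms are written in a monad that counts elementary operations.  Each arithmetic operation on
integers (including division with remainder), each comparison of integers, each construction of a list
cell, and each test of whether a list is empty or a counter is zero costs one unit, whatever the size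
of the integers.  Moving values that are already computed is free. -/

/-- A value, together with the number of elementary operations spent on computing it. -/
structure Timed (α : Type) where
  /-- The computed value. -/
  val : α
  /-- The number of elementary operations. -/
  cost : ℕ

instance : Monad Timed where
  pure a := ⟨a, 0⟩
  bind x f := ⟨(f x.val).val, x.cost + (f x.val).cost⟩

/-- One elementary operation without a value. -/
def tick : Timed Unit := ⟨(), 1⟩

def add (x y : ℤ) : Timed ℤ := ⟨x + y, 1⟩

def sub (x y : ℤ) : Timed ℤ := ⟨x - y, 1⟩

def mul (x y : ℤ) : Timed ℤ := ⟨x * y, 1⟩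

def half (x : ℤ) : Timed ℤ := ⟨x / 2, 1⟩

def abs (x : ℤ) : Timed ℕ := ⟨x.natAbs, 1⟩

def addNat (x y : ℕ) : Timed ℕ := ⟨x + y, 1⟩

def lt (x y : ℤ) : Timed Bool := ⟨decide (x < y), 1⟩

def cons {α : Type} (x : α) (l : List α) : Timed (List α) := ⟨x :: l, 1⟩

/-- The length of a list, computed by a traversal. -/
def length {α : Type} : List α → Timed ℕ
  | [] => do
    tick
    return 0
  | _ :: l => do
    tick
    let k ← length l
    addNat k 1

/-! ### Geometric primitives -/

/-- Positive if `p` lies strictly to the right of the line directed from `a` to `b`, zero if `p` is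
on the line; in general `|b - a|` times the signed distance from `p` to the line. -/
def side (a b p : Pt) : Timed ℤ := do
  let ux ← sub b.1 a.1
  let uy ← sub b.2 a.2
  let vx ← sub p.1 a.1
  let vy ← sub p.2 a.2
  let s ← mul vx uy
  let t ← mul vy ux
  sub s t

/-- Does `p` strictly precede `q` in the direction from `a` to `b`? -/
def precedes (a b p q : Pt) : Timed Bool := do
  let ux ← sub b.1 a.1
  let uy ← sub b.2 a.2
  let vx ← sub q.1 p.1
  let vy ← sub q.2 p.2
  let s ← mul vx ux
  let t ← mul vy uy
  let d ← add s t
  lt 0 d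

/-- Is `p` lower than `q`, or at the same height and to the left of `q`? -/
def lower (p q : Pt) : Timed Bool := do
  if ← lt p.2 q.2 then
    return true
  else if ← lt q.2 p.2 then
    return false
  else
    lt p.1 q.1

/-- The bottom-most point (the leftmost one in case of a tie) of the list and `best`. -/
def bottom (best : Pt) : List Pt → Timed Pt
  | [] => do
    tick
    return best
  | p :: l => do
    tick
    if ← lower p best then bottom p l else bottom best l

/-- The top-most point (the rightmost one in case of a tie) of the list and `best`. -/
def top (best : Pt) : List Pt → Timed Pt
  | [] => do
    tick
    return best
  | p :: l => do
    tick
    if ← lower best p then top p l else top best l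

/-- The points of a list that lie strictly to the right of the line directed from `a` to `b`. -/
def outside (a b : Pt) : List Pt → Timed (List Pt)
  | [] => do
    tick
    return []
  | p :: l => do
    tick
    let s ← side a b p
    let keep ← lt 0 s
    let rest ← outside a b l
    if keep then cons p rest else return rest

/-- Among the points of the list and the points found so far, those farthest to the right of the line
directed from `a` to `b`: the first and the last of them in the direction from `a` to `b`.  Here `best`
is the value of `side a b` at the farthest points found so far, and `d₁`, `d₂` are the first and the
last of these. -/
def farthest (a b : Pt) (best : ℤ) (d₁ d₂ : Pt) : List Pt → Timed (Pt × Pt)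
  | [] => do
    tick
    return (d₁, d₂)
  | p :: l => do
    tick
    let s ← side a b p
    if ← lt best s then
      farthest a b s p p l
    else if ← lt s best then
      farthest a b best d₁ d₂ l
    else if ← precedes a b p d₁ then
      farthest a b best p d₂ l
    else if ← precedes a b d₂ p then
      farthest a b best d₁ p l
    else
      farthest a b best d₁ d₂ l

/-! ### QuickHull

The partial hull is a counterclockwise polygon. -/

/-- A directed edge of the partial hull, from its first to its second point. -/
abbrev Edge : Type := Pt × Pt

/-- An edge `(a, b)` of the partial hull with the list of the remaining points that lie strictly
outside of it, that is, strictly to the right of the line from `a` to `b`. -/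
structure Pocket where
  a : Pt
  b : Pt
  pts : List Pt

/-- The partial hull: its edges that may still have to be replaced, with the remaining points outside
of them, and its edges that are known to be edges of the convex hull. -/
structure PartialHull where
  active : List Pocket
  done : List Edge

/-- Insert an edge in the partial hull: it is an edge of the convex hull if no point remains strictly
outside of it. -/
def insertEdge (a b : Pt) (pts : List Pt) (P : PartialHull) : Timed PartialHull := do
  tick
  match pts with
  | [] => do
    let done ← cons (a, b) P.done
    return ⟨P.active, done⟩
  | p :: l => do
    let active ← cons ⟨a, b, p :: l⟩ P.active
    return ⟨active, P.done⟩

/-- Insert an edge all of whose outer points are known to be discarded, unless it is degenerate. -/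
def insertTopEdge (d₁ d₂ : Pt) (P : PartialHull) : Timed PartialHull := do
  tick
  tick
  if d₁ = d₂ then
    return P
  else
    insertEdge d₁ d₂ [] P

/-- Treat one edge `(a, b)`: find the first point `d₁` and the last point `d₂` among the remaining
points that are farthest from it, insert both between `a` and `b`, keep the remaining points that are
strictly outside of `(a, d₁)` or of `(d₂, b)`, and discard the others.  The resulting edges are
inserted in `P`. -/
def splitEdge (a b : Pt) (pts : List Pt) (P : PartialHull) : Timed PartialHull := do
  tick
  match pts with
  | [] => insertEdge a b [] P
  | p :: l => do
    let s ← side a b p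
    let (d₁, d₂) ← farthest a b s p p l
    let left ← outside a d₁ (p :: l)
    let right ← outside d₂ b (p :: l)
    let P₁ ← insertEdge a d₁ left P
    let P₂ ← insertTopEdge d₁ d₂ P₁
    insertEdge d₂ b right P₂

/-- Treat all edges of a list, and insert the resulting edges in `P`. -/
def splitEdges : List Pocket → PartialHull → Timed PartialHull
  | [], P => do
    tick
    return P
  | e :: l, P => do
    tick
    let P' ← splitEdge e.a e.b e.pts P
    splitEdges l P'

/-- One step of QuickHull: compute the farthest points of every edge of the partial hull. -/
def quickhullStep (P : PartialHull) : Timed PartialHull :=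
  splitEdges P.active ⟨[], P.done⟩

/-- The number of remaining points. -/
def remaining : List Pocket → Timed ℕ
  | [] => do
    tick
    return 0
  | e :: l => do
    tick
    let k ← length e.pts
    let m ← remaining l
    addNat k m

/-- The initial partial hull: the top-most and bottom-most points, and the extreme points in both
directions normal to the line through them. -/
def quickhullInit (p : Pt) (l : List Pt) : Timed PartialHull := do
  let lo ← bottom p l
  let hi ← top p l
  let right ← outside lo hi (p :: l)
  let left ← outside hi lo (p :: l)
  let P₁ ← insertEdge lo hi right ⟨[], []⟩
  let P₂ ← insertEdge hi lo left P₁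
  quickhullStep P₂

/-- QuickHull from a partial hull `P` with `m` remaining points.  It gives up with `none` as soon as a
step discards less than half of the remaining points, and otherwise returns the list of the edges of
the convex hull. -/
def quickhull (m : ℕ) (P : PartialHull) : Timed (Option (List Edge)) := do
  tick
  if _hm : m = 0 then
    return some P.done
  else
    let P' ← quickhullStep P
    let m' ← remaining P'.active
    tick
    tick
    if _h : 2 * m' ≤ m then
      quickhull m' P'
    else
      return none
  termination_by m
  decreasing_by omega

/-! ### Counting lattice points, and the test -/

/-- Euclid's algorithm for the greatest common divisor. -/
def euclid (x y : ℕ) : Timed ℕ := do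
  tick
  if _hy : y = 0 then
    return x
  else
    tick
    euclid y (x % y)
  termination_by y
  decreasing_by exact Nat.mod_lt x (Nat.pos_of_ne_zero _hy)

/-- The sum of the cross products of the end points of the edges (twice the enclosed area), and the sum
of the greatest common divisors of their coordinate differences (the number of lattice points on the
boundary). -/
def pickSums : List Edge → Timed (ℤ × ℤ)
  | [] => do
    tick
    return (0, 0)
  | (a, b) :: l => do
    tick
    let s ← mul a.1 b.2
    let t ← mul a.2 b.1
    let c ← sub s t
    let x ← sub b.1 a.1
    let y ← sub b.2 a.2
    let x' ← abs x
    let y' ← abs y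
    let g ← euclid x' y'
    let (area, bdry) ← pickSums l
    let area' ← add c area
    let bdry' ← add (g : ℤ) bdry
    return (area', bdry')

/-- The number of lattice points of the polygon with the given edges, by Pick's formula
`A + B / 2 + 1`, where `A` is the area and `B` the number of lattice points on the boundary. -/
def latticeCount (H : List Edge) : Timed ℤ := do
  let (area, bdry) ← pickSums H
  let s ← add area bdry
  let t ← half s
  add t 1

/-- The algorithm: run QuickHull, answer `false` if a step discards less than half of the remaining
points, then compare the number of lattice points of the hull with the number of input points. -/
def isDigitalConvex (S : List Pt) : Timed Bool := do
  tick
  match S with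
  | [] => return true
  | p :: l => do
    let n ← length (p :: l)
    let P ← quickhullInit p l
    let m ← remaining P.active
    match ← quickhull m P with
    | none => return false
    | some H => do
      let c ← latticeCount H
      if ← lt n c then return false else return true

end DigitalConvexity

namespace DigitalConvexity

/-! ### Values and costs of the basic operations -/

namespace Timed

/-! Let N be the number of lattice points of conv(S). Correctness rests on a conserved quantity. For
a directed edge ab, add to `weight a b` (a cross product plus a gcd, the summand of twice Pick's
formula) twice the number of lattice points of the hull to the right of ab, `outer S a b`. If d is a
hull vertex to the right of ab, the quantity of ab is the sum of those of ad and db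
(`weight_add_ncard_outer`): the lattice points beyond ab are those of the triangle adb off the side
ab, those beyond ad and those beyond db, and the triangle is counted by `ncard_cap`. Hence a
QuickHull step does not change the sum over all edges (`PartialHull.totalWeight`). Cutting the hull
along its first diagonal gives the value 2N - 2 (`two_mul_ncard_latticeHull`). At the end nothing
lies outside the edges, so the weights alone sum to 2N - 2 and the computed count is exactly N.
Since S lies in its hull, comparing N with |S| decides digital convexity.

It remains to see that a digital convex S never triggers the early exit. In a pocket ab with first
and last farthest points d₁ and d₂, the survivors lie beyond ad₁ or beyond d₂b. Reflecting the
former in the midpoint of ad₁ and the latter in the midpoint of d₂b yields lattice points of the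
triangles ad₁b and ad₂b. By digital convexity they belong to S, and they are discarded points of the
same pocket. The two families of images are disjoint, so at least half of the pocket is discarded
(`IsPocket.two_mul_le`). Both the position and the disjointness of the images come from the strip
between parallel lines through a and b that contains the pocket. For a pocket created by a split,
this strip is bounded by the parallel to the parent edge through its farthest points and by the
parent edge itself.

For the cost, halving makes the QuickHull steps a geometric series of total cost O(n). Euclid's
algorithm takes O(1 + log r) operations per edge. The edges found are exposed segments of the hull
with distinct start points, so there are at most 2h of them (`IsHull.length_le`); the factor two
covers a segment traversed in both directions. -/

@[simp] theorem val_pure {α : Type} (a : α) : (pure a : Timed α).val = a := rfl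

@[simp] theorem cost_pure {α : Type} (a : α) : (pure a : Timed α).cost = 0 := rfl

@[simp] theorem val_bind {α β : Type} (x : Timed α) (f : α → Timed β) :
    (x >>= f).val = (f x.val).val := rfl

@[simp] theorem cost_bind {α β : Type} (x : Timed α) (f : α → Timed β) :
    (x >>= f).cost = x.cost + (f x.val).cost := rfl

theorem val_ite {α : Type} (c : Prop) [Decidable c] (x y : Timed α) :
    (if c then x else y).val = if c then x.val else y.val := apply_ite _ _ _ _

theorem cost_ite {α : Type} (c : Prop) [Decidable c] (x y : Timed α) :
    (if c then x else y).cost = if c then x.cost else y.cost := apply_ite _ _ _ _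

end Timed

@[simp] theorem tick_cost : tick.cost = 1 := rfl

/-- The value of `side a b p`. -/
def orient (a b p : Pt) : ℤ := (p.1 - a.1) * (b.2 - a.2) - (p.2 - a.2) * (b.1 - a.1)

/-- The inner product of `b - a` and `q - p`. -/
def along (a b p q : Pt) : ℤ := (q.1 - p.1) * (b.1 - a.1) + (q.2 - p.2) * (b.2 - a.2)

@[simp] theorem side_val (a b p : Pt) : (side a b p).val = orient a b p := rfl

@[simp] theorem side_cost (a b p : Pt) : (side a b p).cost = 7 := rfl

@[simp] theorem precedes_val (a b p q : Pt) :
    (precedes a b p q).val = decide (0 < along a b p q) := rfl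

@[simp] theorem precedes_cost (a b p q : Pt) : (precedes a b p q).cost = 8 := rfl

@[simp] theorem lt_val (x y : ℤ) : (lt x y).val = decide (x < y) := rfl

@[simp] theorem lt_cost (x y : ℤ) : (lt x y).cost = 1 := rfl

@[simp] theorem cons_val {α : Type} (x : α) (l : List α) : (cons x l).val = x :: l := rfl

@[simp] theorem cons_cost {α : Type} (x : α) (l : List α) : (cons x l).cost = 1 := rfl

@[simp] theorem addNat_val (x y : ℕ) : (addNat x y).val = x + y := rfl

@[simp] theorem addNat_cost (x y : ℕ) : (addNat x y).cost = 1 := rfl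

@[simp] theorem length_val {α : Type} (l : List α) : (length l).val = l.length := by
  induction l with
  | nil => rfl
  | cons x l ih => simp [length, ih]

theorem length_cost {α : Type} (l : List α) : (length l).cost = 2 * l.length + 1 := by
  induction l with
  | nil => rfl
  | cons x l ih => simp [length, ih]; ring

/-! ### The bottom-most and top-most points -/

theorem lower_val (p q : Pt) :
    (lower p q).val = true ↔ p.2 < q.2 ∨ p.2 = q.2 ∧ p.1 < q.1 := by
  simp only [lower, Timed.val_bind, lt_val, Timed.val_ite, Timed.val_pure, decide_eq_true_eq]
  split_ifs with h1 h2
  · simp [h1]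
  · simp; omega
  · simp; omega

theorem lower_cost (p q : Pt) : (lower p q).cost ≤ 3 := by
  simp only [lower, Timed.cost_bind, lt_val, lt_cost, decide_eq_true_eq]
  simp only [Timed.cost_ite, Timed.cost_bind, Timed.cost_pure, lt_cost]
  split_ifs <;> simp

theorem bottom_spec (p : Pt) (l : List Pt) :
    (bottom p l).val ∈ p :: l ∧
      ∀ s ∈ p :: l, (bottom p l).val.2 < s.2 ∨
        (bottom p l).val.2 = s.2 ∧ (bottom p l).val.1 ≤ s.1 := by
  induction l generalizing p with
  | nil => simp [bottom]
  | cons q l ih =>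
    simp only [bottom, Timed.val_bind]
    split_ifs with h
    · rw [lower_val] at h
      obtain ⟨h1, h2⟩ := ih q
      refine ⟨by simp only [List.mem_cons] at h1 ⊢; tauto, ?_⟩
      intro s hs
      simp only [List.mem_cons] at hs h2
      have := h2 q (Or.inl rfl)
      rcases hs with rfl | rfl | hs
      · omega
      · exact this
      · exact h2 s (Or.inr hs)
    · rw [lower_val] at h
      obtain ⟨h1, h2⟩ := ih p
      refine ⟨by simp only [List.mem_cons] at h1 ⊢; tauto, ?_⟩
      intro s hs
      simp only [List.mem_cons] at hs h2
      have := h2 p (Or.inl rfl)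
      rcases hs with rfl | rfl | hs
      · exact this
      · omega
      · exact h2 s (Or.inr hs)

theorem top_spec (p : Pt) (l : List Pt) :
    (top p l).val ∈ p :: l ∧
      ∀ s ∈ p :: l, s.2 < (top p l).val.2 ∨
        s.2 = (top p l).val.2 ∧ s.1 ≤ (top p l).val.1 := by
  induction l generalizing p with
  | nil => simp [top]
  | cons q l ih =>
    simp only [top, Timed.val_bind]
    split_ifs with h
    · rw [lower_val] at h
      obtain ⟨h1, h2⟩ := ih q
      refine ⟨by simp only [List.mem_cons] at h1 ⊢; tauto, ?_⟩
      intro s hs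
      simp only [List.mem_cons] at hs h2
      have := h2 q (Or.inl rfl)
      rcases hs with rfl | rfl | hs
      · omega
      · exact this
      · exact h2 s (Or.inr hs)
    · rw [lower_val] at h
      obtain ⟨h1, h2⟩ := ih p
      refine ⟨by simp only [List.mem_cons] at h1 ⊢; tauto, ?_⟩
      intro s hs
      simp only [List.mem_cons] at hs h2
      have := h2 p (Or.inl rfl)
      rcases hs with rfl | rfl | hs
      · exact this
      · omega
      · exact h2 s (Or.inr hs)

theorem bottom_cost (p : Pt) (l : List Pt) : (bottom p l).cost ≤ 4 * l.length + 1 := by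
  induction l generalizing p with
  | nil => simp [bottom]
  | cons q l ih =>
    simp only [bottom, Timed.cost_bind, tick_cost, List.length_cons]
    have := lower_cost q p
    split_ifs
    · have := ih q; omega
    · have := ih p; omega

theorem top_cost (p : Pt) (l : List Pt) : (top p l).cost ≤ 4 * l.length + 1 := by
  induction l generalizing p with
  | nil => simp [top]
  | cons q l ih =>
    simp only [top, Timed.cost_bind, tick_cost, List.length_cons]
    have := lower_cost p q
    split_ifs
    · have := ih q; omega
    · have := ih p; omega

/-! ### The points outside an edge and the farthest of them -/

@[simp] theorem outside_val (a b : Pt) (l : List Pt) :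
    (outside a b l).val = l.filter (fun p => 0 < orient a b p) := by
  induction l with
  | nil => rfl
  | cons p l ih =>
    simp only [outside, Timed.val_bind, side_val, lt_val, ih, List.filter_cons]
    split_ifs <;> simp

theorem outside_cost (a b : Pt) (l : List Pt) : (outside a b l).cost ≤ 10 * l.length + 1 := by
  induction l with
  | nil => simp [outside]
  | cons p l ih =>
    simp only [outside, Timed.cost_bind, side_cost, lt_cost, tick_cost, List.length_cons]
    split_ifs <;> simp <;> omega

/-- `d₁` and `d₂` are the first and the last of the points of `l` farthest to the right of `ab`. -/
structure IsFarthest (a b d₁ d₂ : Pt) (l : List Pt) : Prop where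
  mem_left : d₁ ∈ l
  mem_right : d₂ ∈ l
  orient_eq : orient a b d₂ = orient a b d₁
  le : ∀ s ∈ l, orient a b s ≤ orient a b d₁
  first : ∀ s ∈ l, orient a b s = orient a b d₁ → 0 ≤ along a b d₁ s
  last : ∀ s ∈ l, orient a b s = orient a b d₁ → 0 ≤ along a b s d₂

theorem IsFarthest.singleton (a b p : Pt) : IsFarthest a b p p [p] := by
  constructor <;> simp [along]

theorem IsFarthest.farthest {a b d₁ d₂ : Pt} {l₀ : List Pt} (h : IsFarthest a b d₁ d₂ l₀)
    (l : List Pt) :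
    IsFarthest a b (farthest a b (orient a b d₁) d₁ d₂ l).val.1
      (farthest a b (orient a b d₁) d₁ d₂ l).val.2 (l₀ ++ l) := by
  induction l generalizing d₁ d₂ l₀ with
  | nil => simpa [DigitalConvexity.farthest] using h
  | cons p l ih =>
    simp only [DigitalConvexity.farthest, Timed.val_bind, side_val, lt_val, decide_eq_true_eq,
      precedes_val, Timed.val_ite]
    have e : l₀ ++ p :: l = (l₀ ++ [p]) ++ l := by simp
    -- The current first point weakly precedes the current last one. So a tied point that precedes
    -- `d₁` cannot come after `d₂`, nor conversely, and updating one end keeps the other correct.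
    have hd := h.first d₂ h.mem_right h.orient_eq
    rw [e]
    split_ifs with h1 h2 h3 h4
    · apply ih
      refine ⟨by simp, by simp, rfl, ?_, ?_, ?_⟩
      · intro s hs
        rcases List.mem_append.1 hs with hs | hs
        · exact (h.le s hs).trans h1.le
        · simp_all
      all_goals
        intro s hs he
        rcases List.mem_append.1 hs with hs | hs
        · have := h.le s hs; omega
        · simp_all [along]
    · apply ih
      refine ⟨by simp [h.mem_left], by simp [h.mem_right], h.orient_eq, ?_, ?_, ?_⟩
      · intro s hs
        rcases List.mem_append.1 hs with hs | hs
        · exact (h.le s hs)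
        · simp_all
      · intro s hs he
        rcases List.mem_append.1 hs with hs | hs
        · exact h.first s hs he
        · simp_all
      · intro s hs he
        rcases List.mem_append.1 hs with hs | hs
        · exact h.last s hs he
        · simp_all
    all_goals have hp : orient a b p = orient a b d₁ := by omega
    · rw [← hp]
      apply ih
      refine ⟨by simp, by simp [h.mem_right], h.orient_eq.trans hp.symm, ?_, ?_, ?_⟩
      · intro s hs
        rcases List.mem_append.1 hs with hs | hs
        · exact hp ▸ (h.le s hs)
        · simp_all
      · intro s hs he
        rcases List.mem_append.1 hs with hs | hs
        · have := h.first s hs (he.trans hp)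
          simp only [along] at *; linarith
        · simp_all [along]
      · intro s hs he
        rcases List.mem_append.1 hs with hs | hs
        · exact h.last s hs (he.trans hp)
        · simp only [List.mem_singleton] at hs
          subst hs
          simp only [along] at *; linarith
    · apply ih
      refine ⟨by simp [h.mem_left], by simp, hp, ?_, ?_, ?_⟩
      · intro s hs
        rcases List.mem_append.1 hs with hs | hs
        · exact (h.le s hs)
        · simp_all
      · intro s hs he
        rcases List.mem_append.1 hs with hs | hs
        · exact h.first s hs he
        · simp only [List.mem_singleton] at hs
          subst hs
          simp only [along] at *; linarith
      · intro s hs he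
        rcases List.mem_append.1 hs with hs | hs
        · have := h.last s hs he
          simp only [along] at *; linarith
        · simp_all [along]
    · apply ih
      refine ⟨by simp [h.mem_left], by simp [h.mem_right], h.orient_eq, ?_, ?_, ?_⟩
      · intro s hs
        rcases List.mem_append.1 hs with hs | hs
        · exact (h.le s hs)
        · simp_all
      · intro s hs he
        rcases List.mem_append.1 hs with hs | hs
        · exact h.first s hs he
        · simp only [List.mem_singleton] at hs
          subst hs
          simp only [along] at *; linarith
      · intro s hs he
        rcases List.mem_append.1 hs with hs | hs
        · exact h.last s hs he
        · simp only [List.mem_singleton] at hs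
          subst hs
          simp only [along] at *; linarith

theorem farthest_cost (a b : Pt) (m : ℤ) (d₁ d₂ : Pt) (l : List Pt) :
    (farthest a b m d₁ d₂ l).cost ≤ 26 * l.length + 1 := by
  induction l generalizing m d₁ d₂ with
  | nil => simp [farthest]
  | cons p l ih =>
    simp only [farthest, Timed.cost_bind, side_val, lt_val, decide_eq_true_eq, side_cost, lt_cost,
      precedes_cost, precedes_val, tick_cost, List.length_cons, Timed.cost_ite]
    have := ih (orient a b p) p p
    have := ih m d₁ d₂
    have := ih m p d₂
    have := ih m d₁ p
    split_ifs <;> omega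

theorem euclid_val (x y : ℕ) : (euclid x y).val = Nat.gcd x y := by
  induction y using Nat.strong_induction_on generalizing x with
  | _ y ih =>
    rw [euclid]
    simp only [Timed.val_bind]
    split_ifs with h
    · simp [h]
    · simp only [Timed.val_bind]
      rw [ih _ (Nat.mod_lt x (Nat.pos_of_ne_zero h)), Nat.gcd_comm x y, Nat.gcd_rec y x,
        Nat.gcd_comm]

/-! ### Pick's formula for a lattice triangle without one of its sides -/

/-- Twice the area swept by the edge `ab` from the origin, plus the number of lattice points of the
half-open edge. -/
def weight (a b : Pt) : ℤ :=
  (a.1 * b.2 - a.2 * b.1) + (Nat.gcd (b.1 - a.1).natAbs (b.2 - a.2).natAbs : ℕ)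

/-- The set is a fundamental domain for the sublattice spanned by d - a and b - a: x - a has
coordinates `orient a b x / D` in (0, 1] and `-orient a d x / D` in [0, 1). Its points thus
represent the cosets once each, and the index is the determinant D. -/
theorem ncard_halfOpen_parallelogram (a b d : Pt) (h : 0 < orient a b d) :
    ({x : Pt | (0 < orient a b x ∧ orient a b x ≤ orient a b d) ∧
      (0 ≤ -orient a d x ∧ -orient a d x < orient a b d)}.ncard : ℤ) = orient a b d := by
  set D := orient a b d with hD
  set A : Matrix (Fin 2) (Fin 2) ℤ := !![d.1 - a.1, b.1 - a.1; d.2 - a.2, b.2 - a.2] with hA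
  have hdet : A.det = D := by
    simp only [hA, Matrix.det_fin_two_of, hD, orient]; ring
  set f : (Fin 2 → ℤ) →ₗ[ℤ] (Fin 2 → ℤ) := Matrix.toLin' A with hf
  have hfdet : LinearMap.det f = D := by rw [hf, LinearMap.det_toLin', hdet]
  have hinj : Function.Injective f := by
    rw [hf, Matrix.toLin'_apply']
    apply Matrix.mulVec_injective_of_det_ne_zero
    rw [hdet]; exact h.ne'
  have hcard := Submodule.natAbs_det_equiv (LinearMap.range f) (LinearEquiv.ofInjective f hinj)
  have hD' : (Nat.card ((Fin 2 → ℤ) ⧸ LinearMap.range f) : ℤ) = D := by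
    have e : (LinearMap.det f).natAbs = Nat.card ((Fin 2 → ℤ) ⧸ LinearMap.range f) := by
      rw [← hcard]; congr 2
    rw [← e, hfdet]; exact Int.natAbs_of_nonneg h.le
  refine Eq.trans ?_ hD'
  rw [← Nat.card_coe_set_eq]
  congr 1
  have hrange : ∀ x : Fin 2 → ℤ, x ∈ LinearMap.range f ↔ ∃ i j : ℤ,
      x 0 = i * (d.1 - a.1) + j * (b.1 - a.1) ∧ x 1 = i * (d.2 - a.2) + j * (b.2 - a.2) := by
    intro x
    constructor
    · rintro ⟨y, rfl⟩
      refine ⟨y 0, y 1, ?_, ?_⟩ <;> simp [hf, hA, Matrix.mulVec, dotProduct, Fin.sum_univ_two] <;>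
        ring
    · rintro ⟨i, j, h0, h1⟩
      refine ⟨![i, j], ?_⟩
      ext k
      fin_cases k <;> simp [hf, hA, Matrix.mulVec, dotProduct, Fin.sum_univ_two, h0, h1] <;> ring
  refine Nat.card_congr (Equiv.ofBijective
    (fun x => Submodule.Quotient.mk (![x.1.1 - a.1, x.1.2 - a.2])) ⟨?_, ?_⟩)
  · rintro ⟨x, ⟨hx1, hx2⟩, hx3, hx4⟩ ⟨y, ⟨hy1, hy2⟩, hy3, hy4⟩ hxy
    rw [Submodule.Quotient.eq, hrange] at hxy
    obtain ⟨i, j, h0, h1⟩ := hxy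
    simp only [Pi.sub_apply, Matrix.cons_val_zero, Matrix.cons_val_one] at h0 h1
    -- Two points of one coset have `orient` values that differ by multiples of D, whereas both
    -- values range over D consecutive integers.
    have e1 : orient a b x - orient a b y = i * D := by
      simp only [hD, orient]; linear_combination (b.2 - a.2) * h0 - (b.1 - a.1) * h1
    have e2 : -orient a d x - -orient a d y = j * D := by
      simp only [hD, orient]; linear_combination -(d.2 - a.2) * h0 + (d.1 - a.1) * h1
    have hi : i = 0 := by
      have h1 : i < 1 := by by_contra hh; nlinarith
      have h2 : -1 < i := by by_contra hh; nlinarith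
      omega
    have hj : j = 0 := by
      have h1 : j < 1 := by by_contra hh; nlinarith
      have h2 : -1 < j := by by_contra hh; nlinarith
      omega
    subst hi hj
    apply Subtype.ext
    apply Prod.ext <;> simp <;> linarith
  · intro q
    obtain ⟨x, rfl⟩ := Submodule.Quotient.mk_surjective _ q
    set X : Pt := (x 0 + a.1, x 1 + a.2) with hX
    -- The shift by one places the remainder in the interval (0, D] instead of [0, D).
    set i := (orient a b X - 1) / D with hi
    set j := (-orient a d X) / D with hj
    have i1 := Int.emod_add_mul_ediv (orient a b X - 1) D
    have i2 := Int.emod_nonneg (orient a b X - 1) h.ne'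
    have i3 := Int.emod_lt_of_pos (orient a b X - 1) h
    have j1 := Int.emod_add_mul_ediv (-orient a d X) D
    have j2 := Int.emod_nonneg (-orient a d X) h.ne'
    have j3 := Int.emod_lt_of_pos (-orient a d X) h
    rw [← hi] at i1
    rw [← hj] at j1
    set Y : Pt := (X.1 - i * (d.1 - a.1) - j * (b.1 - a.1), X.2 - i * (d.2 - a.2) - j * (b.2 - a.2))
      with hY
    have e1 : orient a b Y = orient a b X - D * i := by
      simp only [hY, hD, orient]; ring
    have e2 : -orient a d Y = -orient a d X - D * j := by
      simp only [hY, hD, orient]; ring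
    refine ⟨⟨Y, ⟨by omega, by omega⟩, by omega, by omega⟩, ?_⟩
    rw [Submodule.Quotient.eq, hrange]
    refine ⟨-i, -j, ?_, ?_⟩ <;> simp [hY, hX] <;> ring

/-- The lattice points of a line through `a` and `d`. -/
theorem exists_line_param (a d : Pt) (had : a ≠ d) :
    ∃ w : Pt, w ≠ 0 ∧
      (d.1 - a.1 = (Nat.gcd (d.1 - a.1).natAbs (d.2 - a.2).natAbs : ℕ) * w.1 ∧
        d.2 - a.2 = (Nat.gcd (d.1 - a.1).natAbs (d.2 - a.2).natAbs : ℕ) * w.2) ∧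
      0 < Nat.gcd (d.1 - a.1).natAbs (d.2 - a.2).natAbs ∧
      ∀ x, orient a d x = 0 ↔ ∃ k : ℤ, x = (a.1 + k * w.1, a.2 + k * w.2) := by
  have hg : 0 < Int.gcd (d.1 - a.1) (d.2 - a.2) := by
    rw [Int.gcd_pos_iff]
    by_contra hh
    push Not at hh
    exact had (Prod.ext (by omega) (by omega))
  obtain ⟨w1, w2, hc, h1, h2⟩ := Int.exists_gcd_one hg
  change 0 < Nat.gcd (d.1 - a.1).natAbs (d.2 - a.2).natAbs at hg
  change d.1 - a.1 = w1 * (Nat.gcd (d.1 - a.1).natAbs (d.2 - a.2).natAbs : ℕ) at h1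
  change d.2 - a.2 = w2 * (Nat.gcd (d.1 - a.1).natAbs (d.2 - a.2).natAbs : ℕ) at h2
  set g := Nat.gcd (d.1 - a.1).natAbs (d.2 - a.2).natAbs with hgd
  have hg' : (g : ℤ) ≠ 0 := by exact_mod_cast hg.ne'
  refine ⟨(w1, w2), ?_, ⟨by linarith, by linarith⟩, hg, ?_⟩
  · intro h0
    simp only [Prod.mk_eq_zero] at h0
    rw [h0.1, h0.2] at hc
    simp at hc
  · intro x
    constructor
    · intro hx
      have hx' : (x.1 - a.1) * w2 = (x.2 - a.2) * w1 := by
        apply mul_left_cancel₀ hg'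
        simp only [orient] at hx
        rw [h1, h2] at hx
        linarith
      obtain ⟨p, q, hpq⟩ := Int.isCoprime_iff_gcd_eq_one.2 hc
      refine ⟨p * (x.1 - a.1) + q * (x.2 - a.2), Prod.ext ?_ ?_⟩
      · simp only; linear_combination -(x.1 - a.1) * hpq + q * hx'
      · simp only; linear_combination -(x.2 - a.2) * hpq - p * hx'
    · rintro ⟨k, rfl⟩
      simp only [orient]
      rw [h1, h2]; ring

/-- Lattice points of a segment, located by an affine form `φ` that vanishes at `a`. -/
theorem ncard_segment (a d : Pt) (α β γ : ℤ) (φ : Pt → ℤ)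
    (hφ : ∀ x, φ x = α * x.1 + β * x.2 + γ) (ha : φ a = 0) (hd : 0 < φ d) :
    {x | orient a d x = 0 ∧ 0 < φ x ∧ φ x ≤ φ d}.ncard =
        Nat.gcd (d.1 - a.1).natAbs (d.2 - a.2).natAbs ∧
      {x | orient a d x = 0 ∧ 0 ≤ φ x ∧ φ x ≤ φ d}.ncard =
        Nat.gcd (d.1 - a.1).natAbs (d.2 - a.2).natAbs + 1 ∧
      {x | orient a d x = 0 ∧ 0 < φ x ∧ φ x < φ d}.ncard + 1 =
        Nat.gcd (d.1 - a.1).natAbs (d.2 - a.2).natAbs := by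
  have had : a ≠ d := by rintro rfl; omega
  obtain ⟨w, hw, ⟨h1, h2⟩, hg, hline⟩ := exists_line_param a d had
  set g := Nat.gcd (d.1 - a.1).natAbs (d.2 - a.2).natAbs with hgd
  have hg' : (0 : ℤ) < g := by exact_mod_cast hg
  set F : ℤ → Pt := fun k => (a.1 + k * w.1, a.2 + k * w.2) with hF
  have hinj : Function.Injective F := by
    intro k k' hk
    simp only [hF, Prod.mk.injEq, add_right_inj, mul_eq_mul_right_iff] at hk
    by_contra hne
    apply hw
    exact Prod.ext (by tauto) (by tauto)
  have hval : ∀ k, g * φ (F k) = k * φ d := by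
    intro k
    have e1 : φ d - φ a = g * (α * w.1 + β * w.2) := by
      rw [hφ, hφ]; linear_combination α * h1 + β * h2
    have e2 : φ (F k) - φ a = k * (α * w.1 + β * w.2) := by
      rw [hφ, hφ]; simp only [hF]; ring
    rw [ha] at e1 e2
    linear_combination g * e2 - k * e1
  have key : ∀ (P : ℤ → Prop) (I : Finset ℤ), (∀ k, P (φ (F k)) ↔ k ∈ I) →
      {x | orient a d x = 0 ∧ P (φ x)}.ncard = I.card := by
    intro P I hPI
    rw [← Set.ncard_coe_finset, ← Set.ncard_image_of_injective _ hinj]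
    congr 1
    ext x
    simp only [Set.mem_ofPred_eq, hline, Set.mem_image, SetLike.mem_coe]
    constructor
    · rintro ⟨⟨k, rfl⟩, h⟩
      exact ⟨k, (hPI k).1 h, rfl⟩
    · rintro ⟨k, hk, rfl⟩
      exact ⟨⟨k, rfl⟩, (hPI k).2 hk⟩
  have p1 : ∀ k, 0 < φ (F k) ↔ 0 < k := fun k => by
    have := hval k
    constructor <;> intro h <;> by_contra hh <;> nlinarith
  have p2 : ∀ k, 0 ≤ φ (F k) ↔ 0 ≤ k := fun k => by
    have := hval k
    constructor <;> intro h <;> by_contra hh <;> nlinarith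
  have p3 : ∀ k, φ (F k) ≤ φ d ↔ k ≤ g := fun k => by
    have := hval k
    constructor <;> intro h <;> by_contra hh <;> nlinarith
  have p4 : ∀ k, φ (F k) < φ d ↔ k < g := fun k => by
    have := hval k
    constructor <;> intro h <;> by_contra hh <;> nlinarith
  refine ⟨?_, ?_, ?_⟩
  · rw [key (fun t => 0 < t ∧ t ≤ φ d) (Finset.Ioc 0 g) (fun k => by simp [p1, p3])]; simp
  · rw [key (fun t => 0 ≤ t ∧ t ≤ φ d) (Finset.Icc 0 g) (fun k => by simp [p2, p3])]; simp
  · rw [key (fun t => 0 < t ∧ t < φ d) (Finset.Ioo 0 g) (fun k => by simp [p1, p4])]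
    simp only [Int.card_Ioo]
    omega

/-- The lattice points of the triangle `adb` that do not lie on its side `ab`. -/
def cap (a d b : Pt) : Set Pt :=
  {x | 0 < orient a b x ∧ orient a d x ≤ 0 ∧ orient d b x ≤ 0}

/-- The signed areas cut from the triangle adb by a point add up to that of the triangle, so they
serve as barycentric coordinates. -/
theorem orient_add (a d b x : Pt) :
    orient a b d = orient a b x - orient a d x - orient d b x := by
  simp only [orient]; ring

theorem orient_self_right (a b : Pt) : orient a b b = 0 := by simp only [orient]; ring

theorem orient_self_left (a b : Pt) : orient a b a = 0 := by simp [orient]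

/-- The half-open parallelogram on ad and ab, with D points, is the disjoint union of the cap and
the image under the central symmetry x ↦ d + b - x of `T'`, the open triangle with the open side ab.
Writing I for the interior and gᵢ for the gcds of ad, db and ab, the cap has I + g₁ + (g₂ - 1)
points and `T'` has I + (g₃ - 1). Eliminating I gives 2|cap| = D + g₁ + g₂ - g₃. -/
theorem ncard_cap (a d b : Pt) (h : 0 < orient a b d) :
    (cap a d b).Finite ∧
    2 * ((cap a d b).ncard : ℤ) = weight a d + weight d b - weight a b := by
  have hP := ncard_halfOpen_parallelogram a b d h
  set D := orient a b d with hD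
  have hadd := fun x => orient_add a d b x
  rw [← hD] at hadd
  -- An infinite set has `ncard` zero, so the positive count D already shows finiteness.
  have hPfin := Set.finite_of_ncard_pos (s := {x : Pt | (0 < orient a b x ∧ orient a b x ≤ D) ∧
      (0 ≤ -orient a d x ∧ -orient a d x < D)}) (by omega)
  set P := {x : Pt | (0 < orient a b x ∧ orient a b x ≤ D) ∧
      (0 ≤ -orient a d x ∧ -orient a d x < D)} with hPd
  have hTP : cap a d b ⊆ P := by
    rintro x ⟨h1, h2, h3⟩
    have := hadd x
    exact ⟨⟨h1, by omega⟩, by omega, by omega⟩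
  have hTfin := hPfin.subset hTP
  refine ⟨hTfin, ?_⟩
  set I := {x | 0 < orient a b x ∧ orient a d x < 0 ∧ orient d b x < 0} with hI
  set T' := {x | 0 ≤ orient a b x ∧ orient a d x < 0 ∧ orient d b x < 0} with hT'
  set E1 := {x | orient a d x = 0 ∧ 0 < orient a b x ∧ orient a b x ≤ D} with hE1
  set E2 := {x | orient d b x = 0 ∧ 0 < -orient a d x ∧ -orient a d x < D} with hE2
  set E3 := {x | orient a b x = 0 ∧ 0 < -orient a d x ∧ -orient a d x < D} with hE3
  have hIfin : I.Finite := hTfin.subset (fun x hx => ⟨hx.1, hx.2.1.le, hx.2.2.le⟩)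
  have hE1fin : E1.Finite := hTfin.subset (fun x hx => by
    obtain ⟨h1, h2, h3⟩ := hx
    have := hadd x
    exact ⟨h2, by omega, by omega⟩)
  have hE2fin : E2.Finite := hTfin.subset (fun x hx => by
    obtain ⟨h1, h2, h3⟩ := hx
    have := hadd x
    exact ⟨by omega, by omega, by omega⟩)
  have hbd : -orient a d b = D := by simp only [hD, orient]; ring
  have hg1 := (ncard_segment a d (b.2 - a.2) (-(b.1 - a.1))
    (-a.1 * (b.2 - a.2) + a.2 * (b.1 - a.1)) (orient a b) (fun x => by simp only [orient]; ring)
    (orient_self_left a b) h).1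
  have hg2 := (ncard_segment d b (-(d.2 - a.2)) ((d.1 - a.1))
    (a.1 * (d.2 - a.2) - a.2 * (d.1 - a.1)) (fun x => -orient a d x)
    (fun x => by simp only [orient]; ring)
    (by simp [orient_self_right]) (by simp only [hbd]; exact h)).2.2
  have hg3 := (ncard_segment a b (-(d.2 - a.2)) ((d.1 - a.1))
    (a.1 * (d.2 - a.2) - a.2 * (d.1 - a.1)) (fun x => -orient a d x)
    (fun x => by simp only [orient]; ring)
    (by simp [orient_self_left]) (by simp only [hbd]; exact h)).2.2
  simp only [hbd] at hg2 hg3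
  rw [← hD, ← hE1] at hg1
  rw [← hE2] at hg2
  rw [← hE3] at hg3
  -- The side ab is not contained in the parallelogram, so finiteness needs another argument. If
  -- `ncard` is zero, which could also mean infinite, the gcd is 1 and no integer parameter lies
  -- strictly between 0 and 1.
  have hE3fin : E3.Finite := by
    by_cases h0 : E3.ncard = 0
    · rw [h0] at hg3
      have : Nat.gcd (b.1 - a.1).natAbs (b.2 - a.2).natAbs = 1 := by omega
      obtain ⟨w, hw, ⟨h1, h2⟩, hg, hline⟩ := exists_line_param a b
        (by rintro rfl; simp [orient] at hD; omega)
      rw [this] at h1 h2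
      apply Set.Finite.subset (Set.finite_empty)
      rintro x ⟨hx1, hx2, hx3⟩
      obtain ⟨k, rfl⟩ := (hline x).1 hx1
      have e : -orient a d (a.1 + k * w.1, a.2 + k * w.2) = k * D := by
        simp only [hD, orient]
        push_cast at h1 h2
        rw [h1, h2]; ring
      rw [e] at hx2 hx3
      have : 0 < k := by by_contra hh; nlinarith
      have : k < 1 := by by_contra hh; nlinarith
      omega
    · exact Set.finite_of_ncard_ne_zero h0
  have hT'eq : T' = I ∪ E3 := by
    ext x
    have := hadd x
    simp only [hT', hI, hE3, Set.mem_union, Set.mem_ofPred_eq]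
    omega
  have hT'fin : T'.Finite := hT'eq ▸ hIfin.union hE3fin
  have c1 : T'.ncard = I.ncard + E3.ncard := by
    rw [hT'eq]
    refine Set.ncard_union_eq ?_ hIfin hE3fin
    rw [Set.disjoint_left]
    rintro x hx hx'
    exact hx.1.ne' hx'.1
  have c2 : (cap a d b).ncard = I.ncard + E1.ncard + E2.ncard := by
    have e : cap a d b = (I ∪ E1) ∪ E2 := by
      ext x
      have := hadd x
      simp only [cap, hI, hE1, hE2, Set.mem_union, Set.mem_ofPred_eq]
      omega
    rw [e, Set.ncard_union_eq _ (hIfin.union hE1fin) hE2fin, Set.ncard_union_eq _ hIfin hE1fin]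
    · rw [Set.disjoint_left]
      rintro x hx hx'
      exact hx.2.1.ne hx'.1
    · rw [Set.disjoint_left]
      rintro x (hx | hx) hx'
      · exact hx.2.2.ne hx'.1
      · have := hx.1
        have := hx'.2.1
        omega
  have c3 : P.ncard = (cap a d b).ncard + T'.ncard := by
    set R : Pt → Pt := fun x => (d.1 + b.1 - x.1, d.2 + b.2 - x.2) with hR
    have hRinj : Function.Injective R := by
      intro x y hxy
      simp only [hR, Prod.mk.injEq] at hxy
      exact Prod.ext (by omega) (by omega)
    have r1 : ∀ x, orient a b (R x) = D - orient a b x := fun x => by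
      simp only [hR, hD, orient]; ring
    have r2 : ∀ x, orient a d (R x) = - D - orient a d x := fun x => by
      simp only [hR, hD, orient]; ring
    have e : P = cap a d b ∪ R '' T' := by
      ext x
      have h1 := hadd x
      simp only [hPd, cap, hT', Set.mem_union, Set.mem_ofPred_eq, Set.mem_image]
      constructor
      · rintro ⟨⟨h2, h3⟩, h4, h5⟩
        by_cases h6 : orient d b x ≤ 0
        · left; exact ⟨h2, by omega, h6⟩
        · right
          have := hadd (R x)
          have := r1 x
          have := r2 x
          exact ⟨R x, ⟨by omega, by omega, by omega⟩, Prod.ext (by simp [hR]) (by simp [hR])⟩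
      · rintro (⟨h2, h3, h4⟩ | ⟨y, ⟨h2, h3, h4⟩, rfl⟩)
        · exact ⟨⟨by omega, by omega⟩, by omega, by omega⟩
        · have := hadd y
          have := r1 y
          have := r2 y
          exact ⟨⟨by omega, by omega⟩, by omega, by omega⟩
    rw [e, Set.ncard_union_eq _ hTfin (hT'fin.image R), Set.ncard_image_of_injective _ hRinj]
    rw [Set.disjoint_left]
    rintro x ⟨h1, h2, h3⟩ ⟨y, ⟨h4, h5, h6⟩, rfl⟩
    have := hadd y
    have := hadd (R y)
    have := r1 y
    have := r2 y
    omega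
  have hDw : D = (a.1 * d.2 - a.2 * d.1) + (d.1 * b.2 - d.2 * b.1) - (a.1 * b.2 - a.2 * b.1) := by
    simp only [hD, orient]; ring
  simp only [weight]
  omega

/-! ### The lattice points of the convex hull -/

/-- The lattice points of `conv(S)`. -/
def latticeHull (S : Set Pt) : Set Pt := {x | toPlane x ∈ conv S}

theorem toPlane_injective : Function.Injective toPlane := by
  intro x y h
  have h0 := congrArg (fun v : EuclideanSpace ℝ (Fin 2) => v 0) h
  have h1 := congrArg (fun v : EuclideanSpace ℝ (Fin 2) => v 1) h
  simp only [toPlane, PiLp.toLp_apply, Matrix.cons_val_zero, Matrix.cons_val_one] at h0 h1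
  exact Prod.ext (by exact_mod_cast h0) (by exact_mod_cast h1)

theorem toPlane_zero (x : Pt) : toPlane x 0 = x.1 := by simp [toPlane]

theorem toPlane_one (x : Pt) : toPlane x 1 = x.2 := by simp [toPlane]

theorem subset_latticeHull (S : Set Pt) : S ⊆ latticeHull S := fun _ hx =>
  subset_convexHull ℝ _ (Set.mem_image_of_mem _ hx)

theorem digitalConvex_iff (S : Set Pt) : DigitalConvex S ↔ latticeHull S = S := by
  unfold DigitalConvex latticeHull
  constructor
  · intro h
    ext x
    constructor
    · intro hx
      have : toPlane x ∈ toPlane '' S := h ▸ ⟨hx, x, rfl⟩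
      obtain ⟨y, hy, hyx⟩ := this
      exact toPlane_injective hyx ▸ hy
    · exact fun hx => subset_latticeHull S hx
  · intro h
    ext y
    constructor
    · rintro ⟨hy, x, rfl⟩
      exact ⟨x, h ▸ hy, rfl⟩
    · rintro ⟨x, hx, rfl⟩
      exact ⟨subset_latticeHull S hx, x, rfl⟩

theorem conv_le {S : Set Pt} {y : EuclideanSpace ℝ (Fin 2)} (hy : y ∈ conv S) {u v c : ℝ}
    (h : ∀ s ∈ S, u * s.1 + v * s.2 ≤ c) : u * y 0 + v * y 1 ≤ c := by
  have : conv S ⊆ {y | u * y 0 + v * y 1 ≤ c} := by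
    apply convexHull_min
    · rintro _ ⟨s, hs, rfl⟩
      simpa [toPlane_zero, toPlane_one] using h s hs
    · apply convex_halfSpace_le
      constructor
      · intro x y; simp; ring
      · intro t x; simp; ring
  exact this hy

theorem latticeHull_le {S : Set Pt} {x : Pt} (hx : x ∈ latticeHull S) {u v c : ℤ}
    (h : ∀ s ∈ S, u * s.1 + v * s.2 ≤ c) : u * x.1 + v * x.2 ≤ c := by
  have := conv_le (u := u) (v := v) (c := c) hx (fun s hs => by exact_mod_cast h s hs)
  rw [toPlane_zero, toPlane_one] at this
  exact_mod_cast this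

/-- Integer barycentric coordinates without normalization keep the later verifications polynomial
identities over ℤ. -/
theorem mem_latticeHull_of_combination {S : Set Pt} {a b c x : Pt} (ha : a ∈ S) (hb : b ∈ S)
    (hc : c ∈ S) {k₁ k₂ k₃ : ℤ} (h₁ : 0 ≤ k₁) (h₂ : 0 ≤ k₂) (h₃ : 0 ≤ k₃)
    (hk : 0 < k₁ + k₂ + k₃)
    (hx1 : (k₁ + k₂ + k₃) * x.1 = k₁ * a.1 + k₂ * b.1 + k₃ * c.1)
    (hx2 : (k₁ + k₂ + k₃) * x.2 = k₁ * a.2 + k₂ * b.2 + k₃ * c.2) : x ∈ latticeHull S := by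
  have hconv : Convex ℝ (conv S) := convex_convexHull ℝ _
  have hk' : (0 : ℝ) < k₁ + k₂ + k₃ := by exact_mod_cast hk
  have hmem := fun s (hs : s ∈ S) => subset_latticeHull S hs
  have := hconv.sum_mem (t := Finset.univ) (w := ![(k₁ : ℝ) / (k₁ + k₂ + k₃),
    (k₂ : ℝ) / (k₁ + k₂ + k₃), (k₃ : ℝ) / (k₁ + k₂ + k₃)])
    (z := ![toPlane a, toPlane b, toPlane c])
    (by
      intro i _
      have h₁' : (0 : ℝ) ≤ k₁ := by exact_mod_cast h₁
      have h₂' : (0 : ℝ) ≤ k₂ := by exact_mod_cast h₂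
      have h₃' : (0 : ℝ) ≤ k₃ := by exact_mod_cast h₃
      fin_cases i <;> simp <;> positivity)
    (by simp [Fin.sum_univ_three]; field_simp)
    (by
      intro i _
      fin_cases i
      · exact hmem a ha
      · exact hmem b hb
      · exact hmem c hc)
  change toPlane x ∈ conv S
  convert this using 1
  have e1 : ((k₁ : ℝ) + k₂ + k₃) * x.1 = k₁ * a.1 + k₂ * b.1 + k₃ * c.1 := by exact_mod_cast hx1
  have e2 : ((k₁ : ℝ) + k₂ + k₃) * x.2 = k₁ * a.2 + k₂ * b.2 + k₃ * c.2 := by exact_mod_cast hx2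
  ext i
  fin_cases i
  · simp [Fin.sum_univ_three, toPlane]
    field_simp
    linarith
  · simp [Fin.sum_univ_three, toPlane]
    field_simp
    linarith

theorem finite_latticeHull {S : Set Pt} (hS : S.Finite) : (latticeHull S).Finite := by
  obtain ⟨M, hM⟩ := (hS.image fun s : Pt => |s.1| + |s.2|).bddAbove
  have hM' : ∀ s ∈ S, |s.1| + |s.2| ≤ M := fun s hs => hM ⟨s, hs, rfl⟩
  refine (Set.finite_Icc ((-M, -M) : Pt) (M, M)).subset fun x hx => ?_
  have b1 := latticeHull_le hx (u := 1) (v := 0) (c := M) (fun s hs => by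
    have := hM' s hs; have := abs_nonneg s.2; have := le_abs_self s.1; omega)
  have b2 := latticeHull_le hx (u := -1) (v := 0) (c := M) (fun s hs => by
    have := hM' s hs; have := abs_nonneg s.2; have := neg_abs_le s.1; omega)
  have b3 := latticeHull_le hx (u := 0) (v := 1) (c := M) (fun s hs => by
    have := hM' s hs; have := abs_nonneg s.1; have := le_abs_self s.2; omega)
  have b4 := latticeHull_le hx (u := 0) (v := -1) (c := M) (fun s hs => by
    have := hM' s hs; have := abs_nonneg s.1; have := neg_abs_le s.2; omega)
  exact ⟨⟨by simp only; omega, by simp only; omega⟩, ⟨by simp only; omega, by simp only; omega⟩⟩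

/-- Some linear form attains its maximum over `S` at `a` only. -/
def IsCorner (S : Set Pt) (a : Pt) : Prop :=
  ∃ u v : ℤ, ∀ s ∈ S, s ≠ a → u * s.1 + v * s.2 < u * a.1 + v * a.2

/-! ### Corners and lexicographic maximization -/

/-- On a finite set, a large multiple of the primary form outweighs every difference of the
secondary one. All large N are allowed so that one form can serve two corners at once, as in
`exists_separating_form`. -/
theorem IsCorner.of_lex {S : Set Pt} (hS : S.Finite) {a : Pt} (u v u' v' : ℤ)
    (h : ∀ s ∈ S, s ≠ a → u * s.1 + v * s.2 < u * a.1 + v * a.2 ∨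
      (u * s.1 + v * s.2 = u * a.1 + v * a.2 ∧ u' * s.1 + v' * s.2 < u' * a.1 + v' * a.2)) :
    ∃ N₀ : ℤ, ∀ N ≥ N₀, ∀ s ∈ S, s ≠ a →
      (N * u + u') * s.1 + (N * v + v') * s.2 < (N * u + u') * a.1 + (N * v + v') * a.2 := by
  obtain ⟨M, hM⟩ := (hS.image fun s : Pt =>
    (u' * s.1 + v' * s.2) - (u' * a.1 + v' * a.2)).bddAbove
  have hM' : ∀ s ∈ S, (u' * s.1 + v' * s.2) - (u' * a.1 + v' * a.2) ≤ M :=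
    fun s hs => hM ⟨s, hs, rfl⟩
  refine ⟨|M| + 1, fun N hN s hs hne => ?_⟩
  have hMs := hM' s hs
  have hMa := le_abs_self M
  have hM0 := abs_nonneg M
  have e : (N * u + u') * s.1 + (N * v + v') * s.2
    - ((N * u + u') * a.1 + (N * v + v') * a.2) =
    N * ((u * s.1 + v * s.2) - (u * a.1 + v * a.2))
      + ((u' * s.1 + v' * s.2) - (u' * a.1 + v' * a.2)) := by ring
  rcases h s hs hne with h1 | ⟨h1, h2⟩
  · have : N * ((u * s.1 + v * s.2) - (u * a.1 + v * a.2)) ≤ N * (-1) :=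
      mul_le_mul_of_nonneg_left (by omega) (by omega)
    omega
  · rw [h1, sub_self, mul_zero] at e
    omega

theorem IsCorner.le {S : Set Pt} {a x : Pt} {u v : ℤ} (hx : x ∈ latticeHull S)
    (h : ∀ s ∈ S, s ≠ a → u * s.1 + v * s.2 < u * a.1 + v * a.2) :
    u * x.1 + v * x.2 ≤ u * a.1 + v * a.2 :=
  latticeHull_le hx fun s hs => by
    by_cases hsa : s = a
    · rw [hsa]
    · exact (h s hs hsa).le

/-! ### Half-planes at corners of the hull -/

section Wedge

variable {S : Set Pt} {a b d x : Pt}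

theorem ne_of_orient_pos (h : 0 < orient a b d) : a ≠ b ∧ d ≠ a ∧ d ≠ b := by
  refine ⟨?_, ?_, ?_⟩ <;> rintro rfl <;> simp [orient] at h
  linarith

/-- Expand x - a in the basis d - a, b - a by Cramer's rule. A form that is maximal over S at a only
is negative on both basis vectors, so a hull point to the right of ad but not of ab would give it a
value above its maximum. The next two lemmas use the same argument at b and at d. -/
theorem IsCorner.orient_pos_of_left (hc : IsCorner S a) (hb : b ∈ S) (hd : d ∈ S)
    (h : 0 < orient a b d) (hx : x ∈ latticeHull S) (hxo : 0 < orient a d x) :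
    0 < orient a b x := by
  obtain ⟨u, v, huv⟩ := hc
  obtain ⟨n1, n2, n3⟩ := ne_of_orient_pos h
  have hx' := IsCorner.le hx huv
  have hb' := huv b hb n1.symm
  have hd' := huv d hd n2
  by_contra hneg
  have e : orient a b d * ((u * x.1 + v * x.2) - (u * a.1 + v * a.2)) =
      orient a b x * ((u * d.1 + v * d.2) - (u * a.1 + v * a.2)) -
        orient a d x * ((u * b.1 + v * b.2) - (u * a.1 + v * a.2)) := by
    simp only [orient]; ring
  nlinarith

theorem IsCorner.orient_pos_of_right (hc : IsCorner S b) (ha : a ∈ S) (hd : d ∈ S)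
    (h : 0 < orient a b d) (hx : x ∈ latticeHull S) (hxo : 0 < orient d b x) :
    0 < orient a b x := by
  obtain ⟨u, v, huv⟩ := hc
  obtain ⟨n1, n2, n3⟩ := ne_of_orient_pos h
  have hx' := IsCorner.le hx huv
  have ha' := huv a ha n1
  have hd' := huv d hd n3
  by_contra hneg
  have e : orient a b d * ((u * x.1 + v * x.2) - (u * b.1 + v * b.2)) =
      orient a b x * ((u * d.1 + v * d.2) - (u * b.1 + v * b.2)) -
        orient d b x * ((u * a.1 + v * a.2) - (u * b.1 + v * b.2)) := by
    simp only [orient]; ring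
  nlinarith

theorem IsCorner.orient_nonpos_of_middle (hc : IsCorner S d) (ha : a ∈ S) (hb : b ∈ S)
    (h : 0 < orient a b d) (hx : x ∈ latticeHull S) (hxo : 0 < orient a d x) :
    orient d b x ≤ 0 := by
  obtain ⟨u, v, huv⟩ := hc
  obtain ⟨n1, n2, n3⟩ := ne_of_orient_pos h
  have hx' := IsCorner.le hx huv
  have ha' := huv a ha n2.symm
  have hb' := huv b hb n3.symm
  by_contra hneg
  have e : orient a b d * ((u * x.1 + v * x.2) - (u * d.1 + v * d.2)) =
      - orient a d x * ((u * b.1 + v * b.2) - (u * d.1 + v * d.2)) -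
        orient d b x * ((u * a.1 + v * a.2) - (u * d.1 + v * d.2)) := by
    simp only [orient]; ring
  nlinarith

theorem cap_subset_latticeHull (ha : a ∈ S) (hb : b ∈ S) (hd : d ∈ S) :
    cap a d b ⊆ latticeHull S := by
  rintro x ⟨h1, h2, h3⟩
  refine mem_latticeHull_of_combination hd hb ha (k₁ := orient a b x) (k₂ := -orient a d x)
    (k₃ := -orient d b x) h1.le (by omega) (by omega) (by omega) ?_ ?_ <;>
  · simp only [orient]; ring

/-- The lattice points of `conv(S)` strictly to the right of `ab`. -/
def outer (S : Set Pt) (a b : Pt) : Set Pt := {x ∈ latticeHull S | 0 < orient a b x}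

theorem outer_finite (hS : S.Finite) (a b : Pt) : (outer S a b).Finite :=
  (finite_latticeHull hS).subset fun _ hx => hx.1

/-- The cap of the triangle and the regions beyond ad and db partition the region beyond ab. The
corners a and b keep the two regions inside it, and the corner d keeps them disjoint. -/
theorem weight_add_ncard_outer (hS : S.Finite) (ha : a ∈ S) (hb : b ∈ S) (hd : d ∈ S)
    (ca : IsCorner S a) (cb : IsCorner S b) (cd : IsCorner S d) (h : 0 < orient a b d) :
    weight a b + 2 * ((outer S a b).ncard : ℤ) =
      (weight a d + 2 * ((outer S a d).ncard : ℤ)) +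
        (weight d b + 2 * ((outer S d b).ncard : ℤ)) := by
  obtain ⟨hfin, hcap⟩ := ncard_cap a d b h
  have e : outer S a b = (cap a d b ∪ outer S a d) ∪ outer S d b := by
    ext x
    constructor
    · rintro ⟨hx, hxo⟩
      by_cases h1 : 0 < orient a d x
      · exact Or.inl (Or.inr ⟨hx, h1⟩)
      by_cases h2 : 0 < orient d b x
      · exact Or.inr ⟨hx, h2⟩
      exact Or.inl (Or.inl ⟨hxo, by omega, by omega⟩)
    · rintro ((hx | hx) | hx)
      · exact ⟨cap_subset_latticeHull ha hb hd hx, hx.1⟩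
      · exact ⟨hx.1, ca.orient_pos_of_left hb hd h hx.1 hx.2⟩
      · exact ⟨hx.1, cb.orient_pos_of_right ha hd h hx.1 hx.2⟩
  rw [e, Set.ncard_union_eq _ (hfin.union (outer_finite hS a d)) (outer_finite hS d b),
    Set.ncard_union_eq _ hfin (outer_finite hS a d)]
  · push_cast; linarith
  · rw [Set.disjoint_left]
    intro x hx hx'
    exact absurd hx'.2 (not_lt.2 hx.2.1)
  · rw [Set.disjoint_left]
    rintro x (hx | hx) hx'
    · exact absurd hx'.2 (not_lt.2 hx.2.2)
    · exact absurd hx'.2 (not_lt.2 (cd.orient_nonpos_of_middle ha hb h hx.1 hx.2))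

end Wedge

/-! ### The pockets of the partial hull -/

/-- `pts` are the points of `S` strictly to the right of `ab`, and they lie in a strip that is
bounded by parallel lines through the corners `a` and `b` of `conv(S)`, one of which they miss. -/
structure IsPocket (S : Set Pt) (a b : Pt) (pts : List Pt) : Prop where
  ne : a ≠ b
  mem_left : a ∈ S
  mem_right : b ∈ S
  corner_left : IsCorner S a
  corner_right : IsCorner S b
  mem_iff : ∀ s, s ∈ pts ↔ s ∈ S ∧ 0 < orient a b s
  strip : ∃ u v : ℤ, u * a.1 + v * a.2 < u * b.1 + v * b.2 ∧
    (∀ s ∈ pts, u * a.1 + v * a.2 ≤ u * s.1 + v * s.2 ∧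
      u * s.1 + v * s.2 ≤ u * b.1 + v * b.2) ∧
    ((∀ s ∈ pts, u * a.1 + v * a.2 < u * s.1 + v * s.2) ∨
      (∀ s ∈ pts, u * s.1 + v * s.2 < u * b.1 + v * b.2))

theorem sq_dist_pos {a b : Pt} (h : a ≠ b) :
    0 < (b.1 - a.1) * (b.1 - a.1) + (b.2 - a.2) * (b.2 - a.2) := by
  by_contra hh
  have h1 : b.1 - a.1 = 0 := by nlinarith [mul_self_nonneg (b.1 - a.1), mul_self_nonneg (b.2 - a.2)]
  have h2 : b.2 - a.2 = 0 := by nlinarith [mul_self_nonneg (b.1 - a.1), mul_self_nonneg (b.2 - a.2)]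
  exact h (Prod.ext (by omega) (by omega))

/-- `orient` and `along` measure the components orthogonal and parallel to ab. -/
theorem eq_of_orient_eq_of_along_eq {a b p q : Pt} (h : a ≠ b) (ho : orient a b p = orient a b q)
    (ha : along a b p q = 0) : p = q := by
  have h0 := sq_dist_pos h
  simp only [orient, along] at ho ha
  have e1 : ((b.1 - a.1) * (b.1 - a.1) + (b.2 - a.2) * (b.2 - a.2)) * (q.1 - p.1) = 0 := by
    linear_combination (b.1 - a.1) * ha - (b.2 - a.2) * ho
  have e2 : ((b.1 - a.1) * (b.1 - a.1) + (b.2 - a.2) * (b.2 - a.2)) * (q.2 - p.2) = 0 := by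
    linear_combination (b.2 - a.2) * ha + (b.1 - a.1) * ho
  have e1' := (mul_eq_zero.1 e1).resolve_left h0.ne'
  have e2' := (mul_eq_zero.1 e2).resolve_left h0.ne'
  exact Prod.ext (by omega) (by omega)

/-! ### Splitting a pocket at its farthest points -/

section Split

variable {S : Set Pt} {a b d₁ d₂ : Pt} {l : List Pt}

theorem IsPocket.le_of_mem (h : IsPocket S a b l) (hd : IsFarthest a b d₁ d₂ l) {s : Pt}
    (hs : s ∈ S) : orient a b s ≤ orient a b d₁ := by
  by_cases h0 : 0 < orient a b s
  · exact hd.le s ((h.mem_iff s).2 ⟨hs, h0⟩)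
  · have := ((h.mem_iff d₁).1 hd.mem_left).2
    omega

/-- The point is the lexicographic maximum for the distance from ab, with ties broken backwards
along ab. -/
theorem IsPocket.corner_first (hS : S.Finite) (h : IsPocket S a b l)
    (hd : IsFarthest a b d₁ d₂ l) : IsCorner S d₁ := by
  obtain ⟨N, hN⟩ := IsCorner.of_lex hS (a := d₁) (b.2 - a.2) (-(b.1 - a.1))
    (-(b.1 - a.1)) (-(b.2 - a.2)) (by
    intro s hs hne
    have h1 := h.le_of_mem hd hs
    have h2 := hd.first s
    have h3 := eq_of_orient_eq_of_along_eq (p := d₁) (q := s) h.ne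
    have h4 := ((h.mem_iff d₁).1 hd.mem_left).2
    rcases h1.lt_or_eq with h1 | h1
    · left
      simp only [orient] at h1; linarith
    · right
      have hs' : s ∈ l := (h.mem_iff s).2 ⟨hs, by omega⟩
      have h5 := h2 hs' h1
      have h6 : along a b d₁ s ≠ 0 := fun h0 => hne (h3 h1.symm h0).symm
      have h7 : 0 < along a b d₁ s := by omega
      simp only [orient, along] at h1 h7
      exact ⟨by linarith, by linarith⟩)
  exact ⟨_, _, hN N le_rfl⟩

theorem IsPocket.corner_last (hS : S.Finite) (h : IsPocket S a b l)
    (hd : IsFarthest a b d₁ d₂ l) : IsCorner S d₂ := by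
  obtain ⟨N, hN⟩ := IsCorner.of_lex hS (a := d₂) (b.2 - a.2) (-(b.1 - a.1))
    (b.1 - a.1) (b.2 - a.2) (by
    intro s hs hne
    have h1 := h.le_of_mem hd hs
    have h2 := hd.last s
    have h3 := eq_of_orient_eq_of_along_eq (p := s) (q := d₂) h.ne
    have h4 := ((h.mem_iff d₁).1 hd.mem_left).2
    have h8 := hd.orient_eq
    rcases h1.lt_or_eq with h1 | h1
    · left
      simp only [orient] at h1 h8; linarith
    · right
      have hs' : s ∈ l := (h.mem_iff s).2 ⟨hs, by omega⟩
      have h5 := h2 hs' h1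
      have h6 : along a b s d₂ ≠ 0 := fun h0 => hne (h3 (by omega) h0)
      have h7 : 0 < along a b s d₂ := by omega
      simp only [orient, along] at h1 h7 h8
      exact ⟨by linarith, by linarith⟩)
  exact ⟨_, _, hN N le_rfl⟩

/-- Farthest points span a line parallel to ab, so their orientation form is a rescaled translate of
that of ab. -/
theorem orient_mul_sq_dist (a b d₁ d₂ x : Pt) (h : orient a b d₂ = orient a b d₁) :
    ((b.1 - a.1) * (b.1 - a.1) + (b.2 - a.2) * (b.2 - a.2)) * orient d₁ d₂ x =
      along a b d₁ d₂ * (orient a b x - orient a b d₁) := by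
  simp only [orient, along] at *
  linear_combination ((x.1 - d₁.1) * (b.1 - a.1) + (x.2 - d₁.2) * (b.2 - a.2)) * (-h)

theorem IsFarthest.along_pos (hd : IsFarthest a b d₁ d₂ l) (h : a ≠ b) (hne : d₁ ≠ d₂) :
    0 < along a b d₁ d₂ := by
  refine lt_of_le_of_ne (hd.first d₂ hd.mem_right hd.orient_eq) fun h0 => hne ?_
  exact eq_of_orient_eq_of_along_eq h hd.orient_eq.symm h0.symm

/-- Together these say that a, d₁, d₂, b are in convex position, which makes the wedge lemmas
applicable to the triangles d₁d₂b and ad₂d₁. -/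
theorem IsPocket.orient_last_pos (h : IsPocket S a b l) (hd : IsFarthest a b d₁ d₂ l)
    (hne : d₁ ≠ d₂) : 0 < orient d₁ b d₂ ∧ 0 < orient a d₂ d₁ := by
  have h1 := orient_mul_sq_dist a b d₁ d₂ b hd.orient_eq
  have h1' := orient_mul_sq_dist a b d₁ d₂ a hd.orient_eq
  have h2 := hd.along_pos h.ne hne
  have h3 := ((h.mem_iff d₁).1 hd.mem_left).2
  have h4 := sq_dist_pos h.ne
  rw [orient_self_right, zero_sub] at h1
  rw [orient_self_left, zero_sub] at h1'
  have h5 := mul_pos h2 h3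
  have e1 : orient d₁ b d₂ = - orient d₁ d₂ b := by simp only [orient]; ring
  have e2 : orient a d₂ d₁ = - orient d₁ d₂ a := by simp only [orient]; ring
  rw [e1, e2]
  constructor <;> by_contra hneg <;> nlinarith

/-- The edge between the farthest points is an edge of the convex hull. -/
theorem IsPocket.top (hS : S.Finite) (h : IsPocket S a b l) (hd : IsFarthest a b d₁ d₂ l)
    (hne : d₁ ≠ d₂) : IsPocket S d₁ d₂ [] where
  ne := hne
  mem_left := ((h.mem_iff d₁).1 hd.mem_left).1
  mem_right := ((h.mem_iff d₂).1 hd.mem_right).1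
  corner_left := h.corner_first hS hd
  corner_right := h.corner_last hS hd
  mem_iff s := by
    simp only [List.not_mem_nil, false_iff, not_and, not_lt]
    intro hs
    have h1 := orient_mul_sq_dist a b d₁ d₂ s hd.orient_eq
    have h2 := hd.along_pos h.ne hne
    have h3 := h.le_of_mem hd hs
    have h4 := sq_dist_pos h.ne
    by_contra hneg
    nlinarith
  strip := ⟨d₂.1 - d₁.1, d₂.2 - d₁.2, by
    have := sq_dist_pos hne
    linarith, by simp, by simp⟩

theorem IsPocket.left (hS : S.Finite) (h : IsPocket S a b l) (hd : IsFarthest a b d₁ d₂ l) :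
    IsPocket S a d₁ (l.filter fun p => 0 < orient a d₁ p) where
  ne := by
    have := (ne_of_orient_pos ((h.mem_iff d₁).1 hd.mem_left).2).2.1
    exact this.symm
  mem_left := h.mem_left
  mem_right := ((h.mem_iff d₁).1 hd.mem_left).1
  corner_left := h.corner_left
  corner_right := h.corner_first hS hd
  mem_iff s := by
    simp only [List.mem_filter, h.mem_iff, decide_eq_true_eq]
    have hd1 := (h.mem_iff d₁).1 hd.mem_left
    constructor
    · rintro ⟨⟨h1, h2⟩, h3⟩
      exact ⟨h1, h3⟩
    · rintro ⟨h1, h3⟩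
      exact ⟨⟨h1, h.corner_left.orient_pos_of_left h.mem_right hd1.1 hd1.2
        (subset_latticeHull S h1) h3⟩, h3⟩
  -- The form is `orient a b` up to a constant. It is minimal on the parent edge, which contains a
  -- and which the points of the pocket miss, and it is maximal at `d₁`.
  strip := by
    have hd1 := ((h.mem_iff d₁).1 hd.mem_left).2
    refine ⟨b.2 - a.2, -(b.1 - a.1), ?_, ?_, Or.inl ?_⟩
    · simp only [orient] at hd1; linarith
    · intro s hs
      have h1 := ((h.mem_iff s).1 (List.mem_of_mem_filter hs)).2
      have h2 := hd.le s (List.mem_of_mem_filter hs)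
      simp only [orient] at h1 h2
      constructor <;> linarith
    · intro s hs
      have h1 := ((h.mem_iff s).1 (List.mem_of_mem_filter hs)).2
      simp only [orient] at h1; linarith

theorem IsPocket.right (hS : S.Finite) (h : IsPocket S a b l) (hd : IsFarthest a b d₁ d₂ l) :
    IsPocket S d₂ b (l.filter fun p => 0 < orient d₂ b p) where
  ne := by
    have := (ne_of_orient_pos ((h.mem_iff d₂).1 hd.mem_right).2).2.2
    exact this
  mem_left := ((h.mem_iff d₂).1 hd.mem_right).1
  mem_right := h.mem_right
  corner_left := h.corner_last hS hd
  corner_right := h.corner_right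
  mem_iff s := by
    simp only [List.mem_filter, h.mem_iff, decide_eq_true_eq]
    have hd1 := (h.mem_iff d₂).1 hd.mem_right
    constructor
    · rintro ⟨⟨h1, h2⟩, h3⟩
      exact ⟨h1, h3⟩
    · rintro ⟨h1, h3⟩
      exact ⟨⟨h1, h.corner_right.orient_pos_of_right h.mem_left hd1.1 hd1.2
        (subset_latticeHull S h1) h3⟩, h3⟩
  -- The sign is reversed so that the form increases from `d₂` to b; now the line through b is the
  -- one that is missed.
  strip := by
    have hd1 := ((h.mem_iff d₂).1 hd.mem_right).2
    refine ⟨-(b.2 - a.2), (b.1 - a.1), ?_, ?_, Or.inr ?_⟩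
    · simp only [orient] at hd1; linarith
    · intro s hs
      have h1 := ((h.mem_iff s).1 (List.mem_of_mem_filter hs)).2
      have h2 := hd.le s (List.mem_of_mem_filter hs)
      rw [← hd.orient_eq] at h2
      simp only [orient] at h1 h2
      constructor <;> linarith
    · intro s hs
      have h1 := ((h.mem_iff s).1 (List.mem_of_mem_filter hs)).2
      simp only [orient] at h1; linarith

theorem IsPocket.disjoint (hS : S.Finite) (h : IsPocket S a b l) (hd : IsFarthest a b d₁ d₂ l)
    {s : Pt} (hs : s ∈ latticeHull S) (hl : 0 < orient a d₁ s) : orient d₂ b s ≤ 0 := by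
  have hd1 := (h.mem_iff d₁).1 hd.mem_left
  have hd2 := (h.mem_iff d₂).1 hd.mem_right
  by_contra hr
  push Not at hr
  have hr' : 0 < orient d₁ b s := by
    by_cases hne : d₁ = d₂
    · rwa [hne]
    · exact h.corner_right.orient_pos_of_right hd1.1 hd2.1 (h.orient_last_pos hd hne).1 hs hr
  exact absurd hr' (not_lt.2 ((h.corner_first hS hd).orient_nonpos_of_middle h.mem_left
    h.mem_right hd1.2 hs hl))

/-- The corner d₁ is inserted into ab, and then d₂ into d₁b if it is a different point. -/
theorem IsPocket.weight_split (hS : S.Finite) (h : IsPocket S a b l)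
    (hd : IsFarthest a b d₁ d₂ l) :
    weight a b + 2 * ((outer S a b).ncard : ℤ) =
      (weight a d₁ + 2 * ((outer S a d₁).ncard : ℤ)) +
      (if d₁ = d₂ then 0 else weight d₁ d₂ + 2 * ((outer S d₁ d₂).ncard : ℤ)) +
        (weight d₂ b + 2 * ((outer S d₂ b).ncard : ℤ)) := by
  have hd1 := (h.mem_iff d₁).1 hd.mem_left
  have hd2 := (h.mem_iff d₂).1 hd.mem_right
  have e1 := weight_add_ncard_outer hS h.mem_left h.mem_right hd1.1 h.corner_left h.corner_right
    (h.corner_first hS hd) hd1.2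
  split_ifs with hne
  · subst hne; rw [e1]; ring
  · have e2 := weight_add_ncard_outer hS hd1.1 h.mem_right hd2.1 (h.corner_first hS hd)
      h.corner_right (h.corner_last hS hd) (h.orient_last_pos hd hne).1
    rw [e1, e2]; ring

theorem IsPocket.outer_eq_empty (h : IsPocket S a b []) : outer S a b = ∅ := by
  rw [Set.eq_empty_iff_forall_notMem]
  rintro x ⟨hx, hxo⟩
  have := latticeHull_le hx (u := b.2 - a.2) (v := -(b.1 - a.1))
    (c := a.1 * (b.2 - a.2) - a.2 * (b.1 - a.1)) (by
      intro s hs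
      have h1 : ¬ (s ∈ S ∧ 0 < orient a b s) := fun hh => by simpa using (h.mem_iff s).2 hh
      have h2 : ¬ 0 < orient a b s := fun hh => h1 ⟨hs, hh⟩
      simp only [orient] at h2
      linarith)
  simp only [orient] at hxo
  linarith

/-- The central symmetry about the midpoint of `ad₁` maps the points beyond `ad₁` to points of the
triangle `ad₁b`. -/
theorem IsPocket.reflect_left (h : IsPocket S a b l) (hd : IsFarthest a b d₁ d₂ l) {p : Pt}
    (hp : p ∈ l) (hpo : 0 < orient a d₁ p) :
    (a.1 + d₁.1 - p.1, a.2 + d₁.2 - p.2) ∈ cap a d₁ b := by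
  have hd1 := (h.mem_iff d₁).1 hd.mem_left
  have hp1 := (h.mem_iff p).1 hp
  have hle := hd.le p hp
  have hD := sq_dist_pos h.ne
  -- A point as far from ab as `d₁` comes at or after it, so it is not strictly to the right of ad₁.
  have hlt : orient a b p < orient a b d₁ := by
    refine lt_of_le_of_ne hle fun he => ?_
    have h1 := hd.first p hp he
    have e : ((b.1 - a.1) * (b.1 - a.1) + (b.2 - a.2) * (b.2 - a.2)) * orient a d₁ p =
        - orient a b d₁ * along a b d₁ p := by
      simp only [orient, along] at he ⊢
      linear_combination ((d₁.1 - a.1) * (b.1 - a.1) + (d₁.2 - a.2) * (b.2 - a.2)) * he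
    nlinarith [mul_nonneg hd1.2.le h1, mul_pos hD hpo]
  refine ⟨?_, ?_, ?_⟩
  · have : orient a b (a.1 + d₁.1 - p.1, a.2 + d₁.2 - p.2) = orient a b d₁ - orient a b p := by
      simp only [orient]; ring
    omega
  · have : orient a d₁ (a.1 + d₁.1 - p.1, a.2 + d₁.2 - p.2) = - orient a d₁ p := by
      simp only [orient]; ring
    omega
  · obtain ⟨u, v, hab, hst, -⟩ := h.strip
    by_contra hneg
    push Not at hneg
    set t := orient d₁ b (a.1 + d₁.1 - p.1, a.2 + d₁.2 - p.2) with ht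
    -- The left side combines two differences of strip levels, each at most the width of the strip,
    -- with nonnegative coefficients of sum `orient a b d₁`. So t cannot be positive.
    have e : orient a b p * ((u * d₁.1 + v * d₁.2) - (u * p.1 + v * p.2)) +
        (orient a b d₁ - orient a b p) * ((u * b.1 + v * b.2) - (u * p.1 + v * p.2)) =
        (orient a b d₁ + t) * ((u * b.1 + v * b.2) - (u * a.1 + v * a.2)) := by
      simp only [ht, orient]; ring
    have h1 := hst p hp
    have h2 := hst d₁ hd.mem_left
    have m1 := mul_le_mul_of_nonneg_left (a := orient a b p)
      (show (u * d₁.1 + v * d₁.2) - (u * p.1 + v * p.2) ≤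
        (u * b.1 + v * b.2) - (u * a.1 + v * a.2) by omega) hp1.2.le
    have m2 := mul_le_mul_of_nonneg_left (a := orient a b d₁ - orient a b p)
      (show (u * b.1 + v * b.2) - (u * p.1 + v * p.2) ≤
        (u * b.1 + v * b.2) - (u * a.1 + v * a.2) by omega) (by omega)
    have m3 : 0 < t * ((u * b.1 + v * b.2) - (u * a.1 + v * a.2)) := mul_pos hneg (by omega)
    nlinarith

theorem IsPocket.reflect_right (h : IsPocket S a b l) (hd : IsFarthest a b d₁ d₂ l) {p : Pt}
    (hp : p ∈ l) (hpo : 0 < orient d₂ b p) :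
    (d₂.1 + b.1 - p.1, d₂.2 + b.2 - p.2) ∈ cap a d₂ b := by
  have hd1 := (h.mem_iff d₂).1 hd.mem_right
  have hp1 := (h.mem_iff p).1 hp
  have hle := hd.le p hp
  rw [← hd.orient_eq] at hle
  have hD := sq_dist_pos h.ne
  have hlt : orient a b p < orient a b d₂ := by
    refine lt_of_le_of_ne hle fun he => ?_
    have h1 := hd.last p hp (he.trans hd.orient_eq)
    have e : ((b.1 - a.1) * (b.1 - a.1) + (b.2 - a.2) * (b.2 - a.2)) * orient d₂ b p =
        - orient a b d₂ * along a b p d₂ := by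
      simp only [orient, along] at he ⊢
      linear_combination -((d₂.1 - b.1) * (b.1 - a.1) + (d₂.2 - b.2) * (b.2 - a.2)) * he
    nlinarith [mul_nonneg hd1.2.le h1, mul_pos hD hpo]
  refine ⟨?_, ?_, ?_⟩
  · have : orient a b (d₂.1 + b.1 - p.1, d₂.2 + b.2 - p.2) = orient a b d₂ - orient a b p := by
      simp only [orient]; ring
    omega
  · obtain ⟨u, v, hab, hst, -⟩ := h.strip
    by_contra hneg
    push Not at hneg
    set t := orient a d₂ (d₂.1 + b.1 - p.1, d₂.2 + b.2 - p.2) with ht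
    have e : orient a b p * ((u * p.1 + v * p.2) - (u * d₂.1 + v * d₂.2)) +
        (orient a b d₂ - orient a b p) * ((u * p.1 + v * p.2) - (u * a.1 + v * a.2)) =
        (orient a b d₂ + t) * ((u * b.1 + v * b.2) - (u * a.1 + v * a.2)) := by
      simp only [ht, orient]; ring
    have h1 := hst p hp
    have h2 := hst d₂ hd.mem_right
    have m1 := mul_le_mul_of_nonneg_left (a := orient a b p)
      (show (u * p.1 + v * p.2) - (u * d₂.1 + v * d₂.2) ≤
        (u * b.1 + v * b.2) - (u * a.1 + v * a.2) by omega) hp1.2.le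
    have m2 := mul_le_mul_of_nonneg_left (a := orient a b d₂ - orient a b p)
      (show (u * p.1 + v * p.2) - (u * a.1 + v * a.2) ≤
        (u * b.1 + v * b.2) - (u * a.1 + v * a.2) by omega) (by omega)
    have m3 : 0 < t * ((u * b.1 + v * b.2) - (u * a.1 + v * a.2)) := mul_pos hneg (by omega)
    nlinarith
  · have : orient d₂ b (d₂.1 + b.1 - p.1, d₂.2 + b.2 - p.2) = - orient d₂ b p := by
      simp only [orient]; ring
    omega

/-- The reflected points on both sides are different. -/
theorem IsPocket.reflect_ne (h : IsPocket S a b l) (hd : IsFarthest a b d₁ d₂ l) {p q : Pt}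
    (hp : p ∈ l) (hq : q ∈ l) :
    (a.1 + d₁.1 - p.1, a.2 + d₁.2 - p.2) ≠ (d₂.1 + b.1 - q.1, d₂.2 + b.2 - q.2) := by
  intro heq
  simp only [Prod.mk.injEq] at heq
  obtain ⟨u, v, hab, hst, hor⟩ := h.strip
  have h1 := hst p hp
  have h2 := hst q hq
  have hal := hd.first d₂ hd.mem_right hd.orient_eq
  have hD := sq_dist_pos h.ne
  have e : ((b.1 - a.1) * (b.1 - a.1) + (b.2 - a.2) * (b.2 - a.2)) *
      ((u * d₂.1 + v * d₂.2) - (u * d₁.1 + v * d₁.2)) =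
      along a b d₁ d₂ * ((u * b.1 + v * b.2) - (u * a.1 + v * a.2)) := by
    have := hd.orient_eq
    simp only [orient, along] at this ⊢
    linear_combination (u * (b.2 - a.2) - v * (b.1 - a.1)) * this
  have h3 : 0 ≤ (u * d₂.1 + v * d₂.2) - (u * d₁.1 + v * d₁.2) := by
    by_contra hneg
    nlinarith [mul_nonneg hal (sub_pos.2 hab).le]
  -- If the images coincided, q - p would be (b - a) + (d₂ - d₁). Its level difference is at least
  -- the width of the strip, which is impossible since the pocket misses one of the bounding lines.
  have e2 : (u * q.1 + v * q.2) - (u * p.1 + v * p.2) =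
      (u * b.1 + v * b.2) - (u * a.1 + v * a.2) +
      ((u * d₂.1 + v * d₂.2) - (u * d₁.1 + v * d₁.2)) := by
    linear_combination u * heq.1 + v * heq.2
  rcases hor with hor | hor
  · have := hor p hp
    omega
  · have := hor q hq
    omega

/-- If `S` is digital convex, then at least half of the points of a pocket are discarded. -/
theorem IsPocket.two_mul_le (hS : S.Finite) (hdc : latticeHull S = S) (h : IsPocket S a b l)
    (hl : l.Nodup) (hd : IsFarthest a b d₁ d₂ l) :
    2 * ((l.filter fun p => 0 < orient a d₁ p).length +
      (l.filter fun p => 0 < orient d₂ b p).length) ≤ l.length := by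
  classical
  have hd1 := (h.mem_iff d₁).1 hd.mem_left
  have hd2 := (h.mem_iff d₂).1 hd.mem_right
  set A := l.toFinset.filter fun p => 0 < orient a d₁ p with hA
  set B := l.toFinset.filter fun p => 0 < orient d₂ b p with hB
  have cA : A.card = (l.filter fun p => 0 < orient a d₁ p).length := by
    rw [← List.toFinset_card_of_nodup (hl.filter _), List.toFinset_filter]; simp [hA]
  have cB : B.card = (l.filter fun p => 0 < orient d₂ b p).length := by
    rw [← List.toFinset_card_of_nodup (hl.filter _), List.toFinset_filter]; simp [hB]
  have cl : l.toFinset.card = l.length := List.toFinset_card_of_nodup hl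
  have hdisj : Disjoint A B := by
    rw [Finset.disjoint_left]
    intro s hs hs'
    simp only [hA, hB, Finset.mem_filter, List.mem_toFinset] at hs hs'
    have := h.disjoint hS hd (subset_latticeHull S ((h.mem_iff s).1 hs.1).1) hs.2
    omega
  set f : Pt → Pt := fun p => (a.1 + d₁.1 - p.1, a.2 + d₁.2 - p.2) with hf
  set g : Pt → Pt := fun p => (d₂.1 + b.1 - p.1, d₂.2 + b.2 - p.2) with hg
  have finj : Function.Injective f := by
    intro x y hxy
    simp only [hf, Prod.mk.injEq] at hxy
    exact Prod.ext (by omega) (by omega)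
  have ginj : Function.Injective g := by
    intro x y hxy
    simp only [hg, Prod.mk.injEq] at hxy
    exact Prod.ext (by omega) (by omega)
  have hfA : ∀ p ∈ A, f p ∈ l.toFinset \ (A ∪ B) := by
    intro p hp
    simp only [hA, Finset.mem_filter, List.mem_toFinset] at hp
    have hc := h.reflect_left hd hp.1 hp.2
    have hm := cap_subset_latticeHull h.mem_left h.mem_right hd1.1 hc
    obtain ⟨c1, c2, c3⟩ := hc
    -- Here digital convexity turns a lattice point of the triangle into a point of S.
    have hm' : f p ∈ S := hdc ▸ hm
    have hfl : f p ∈ l := (h.mem_iff _).2 ⟨hm', c1⟩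
    simp only [hA, hB, Finset.mem_sdiff, Finset.mem_union, Finset.mem_filter, List.mem_toFinset,
      hfl, true_and, not_or, not_lt]
    refine ⟨c2, ?_⟩
    by_cases hne : d₁ = d₂
    · rw [← hne]; exact c3
    · by_contra hneg
      push Not at hneg
      exact absurd (h.corner_right.orient_pos_of_right hd1.1 hd2.1 (h.orient_last_pos hd hne).1
        hm hneg) (not_lt.2 c3)
  have hgB : ∀ p ∈ B, g p ∈ l.toFinset \ (A ∪ B) := by
    intro p hp
    simp only [hB, Finset.mem_filter, List.mem_toFinset] at hp
    have hc := h.reflect_right hd hp.1 hp.2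
    have hm := cap_subset_latticeHull h.mem_left h.mem_right hd2.1 hc
    obtain ⟨c1, c2, c3⟩ := hc
    have hm' : g p ∈ S := hdc ▸ hm
    have hfl : g p ∈ l := (h.mem_iff _).2 ⟨hm', c1⟩
    simp only [hA, hB, Finset.mem_sdiff, Finset.mem_union, Finset.mem_filter, List.mem_toFinset,
      hfl, true_and, not_or, not_lt]
    refine ⟨?_, c3⟩
    by_cases hne : d₁ = d₂
    · rw [hne]; exact c2
    · by_contra hneg
      push Not at hneg
      exact absurd (h.corner_left.orient_pos_of_left hd2.1 hd1.1 (h.orient_last_pos hd hne).2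
        hm hneg) (not_lt.2 c2)
  have hsub : A.image f ∪ B.image g ⊆ l.toFinset \ (A ∪ B) := by
    apply Finset.union_subset
    · intro x hx
      obtain ⟨p, hp, rfl⟩ := Finset.mem_image.1 hx
      exact hfA p hp
    · intro x hx
      obtain ⟨p, hp, rfl⟩ := Finset.mem_image.1 hx
      exact hgB p hp
  have hdisj' : Disjoint (A.image f) (B.image g) := by
    rw [Finset.disjoint_left]
    intro x hx hx'
    obtain ⟨p, hp, rfl⟩ := Finset.mem_image.1 hx
    obtain ⟨q, hq, hqp⟩ := Finset.mem_image.1 hx'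
    simp only [hA, hB, Finset.mem_filter, List.mem_toFinset] at hp hq
    exact h.reflect_ne hd hp.1 hq.1 hqp.symm
  have c1 := Finset.card_le_card hsub
  have c2 : A ∪ B ⊆ l.toFinset :=
    Finset.union_subset (Finset.filter_subset _ _) (Finset.filter_subset _ _)
  have c3 := Finset.card_le_card c2
  rw [Finset.card_union_of_disjoint hdisj', Finset.card_image_of_injective _ finj,
    Finset.card_image_of_injective _ ginj, Finset.card_sdiff_of_subset c2,
    Finset.card_union_of_disjoint hdisj] at c1
  rw [Finset.card_union_of_disjoint hdisj] at c3
  omega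

end Split

/-! ### The invariants of QuickHull -/

/-- The partial hull `P` with the edge `ab`. -/
def PartialHull.insert (a b : Pt) (pts : List Pt) (P : PartialHull) : PartialHull :=
  match pts with
  | [] => ⟨P.active, (a, b) :: P.done⟩
  | p :: l => ⟨⟨a, b, p :: l⟩ :: P.active, P.done⟩

theorem insertEdge_val (a b : Pt) (pts : List Pt) (P : PartialHull) :
    (insertEdge a b pts P).val = P.insert a b pts := by
  cases pts <;> rfl

theorem insertEdge_cost (a b : Pt) (pts : List Pt) (P : PartialHull) :
    (insertEdge a b pts P).cost = 2 := by
  cases pts <;> rfl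

theorem insertTopEdge_val (a b : Pt) (P : PartialHull) :
    (insertTopEdge a b P).val = if a = b then P else P.insert a b [] := by
  simp only [insertTopEdge, Timed.val_bind, Timed.val_ite, insertEdge_val, Timed.val_pure]

theorem insertTopEdge_cost (a b : Pt) (P : PartialHull) : (insertTopEdge a b P).cost ≤ 4 := by
  simp only [insertTopEdge, Timed.cost_bind, Timed.cost_ite, insertEdge_cost, Timed.cost_pure,
    tick_cost]
  split_ifs <;> simp

/-- The number of points in the given pockets. -/
def numPoints (l : List Pocket) : ℕ := (l.map fun e => e.pts.length).sum

theorem remaining_val (l : List Pocket) : (remaining l).val = numPoints l := by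
  induction l with
  | nil => rfl
  | cons e l ih => simp [remaining, numPoints, ih]

theorem remaining_cost (l : List Pocket) (h : ∀ e ∈ l, e.pts ≠ []) :
    (remaining l).cost ≤ 5 * numPoints l + 1 := by
  induction l with
  | nil => simp [remaining]
  | cons e l ih =>
    have := ih fun e he => h e (List.mem_cons_of_mem _ he)
    have h2 := List.length_pos_of_ne_nil (h e List.mem_cons_self)
    simp only [remaining, Timed.cost_bind, tick_cost, length_cost, addNat_cost, numPoints,
      List.map_cons, List.sum_cons] at *
    omega

/-- The start points of the edges of the given pockets, and their points. -/
def pocketPoints (l : List Pocket) : Multiset Pt :=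
  (l.map fun e => e.a ::ₘ (e.pts : Multiset Pt)).sum

/-- The start points of the edges of a partial hull, and its remaining points. -/
def PartialHull.points (P : PartialHull) : Multiset Pt :=
  (P.done.map Prod.fst : List Pt) + pocketPoints P.active

/-- The sum of the weights of the edges of the polygon into which the pockets will be turned. -/
noncomputable def pocketWeight (S : Set Pt) (l : List Pocket) : ℤ :=
  (l.map fun e => weight e.a e.b + 2 * ((outer S e.a e.b).ncard : ℤ)).sum

/-- The sum of the weights of the edges of the final hull. -/
noncomputable def PartialHull.totalWeight (S : Set Pt) (P : PartialHull) : ℤ :=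
  (P.done.map fun e => weight e.1 e.2).sum + pocketWeight S P.active

/-- All pockets of a list are proper. -/
def GoodPockets (S : Set Pt) (l : List Pocket) : Prop :=
  ∀ e ∈ l, e.pts ≠ [] ∧ e.pts.Nodup ∧ IsPocket S e.a e.b e.pts

/-- All edges of a partial hull bound proper pockets. -/
structure PartialHull.Good (S : Set Pt) (P : PartialHull) : Prop where
  active : GoodPockets S P.active
  done : ∀ e ∈ P.done, IsPocket S e.1 e.2 []

theorem PartialHull.points_insert (a b : Pt) (pts : List Pt) (P : PartialHull) :
    (P.insert a b pts).points = P.points + a ::ₘ (pts : Multiset Pt) := by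
  cases pts with
  | nil =>
    simp only [PartialHull.insert, PartialHull.points, List.map_cons, ← Multiset.cons_coe,
      ← Multiset.singleton_add, Multiset.coe_nil]
    abel
  | cons p l =>
    simp only [PartialHull.insert, PartialHull.points, pocketPoints, List.map_cons, List.sum_cons]
    abel

theorem PartialHull.totalWeight_insert {S : Set Pt} {a b : Pt} {pts : List Pt}
    (h : IsPocket S a b pts) (P : PartialHull) :
    (P.insert a b pts).totalWeight S =
      P.totalWeight S + (weight a b + 2 * ((outer S a b).ncard : ℤ)) := by
  cases pts with
  | nil =>
    simp only [PartialHull.insert, PartialHull.totalWeight, List.map_cons, List.sum_cons,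
      h.outer_eq_empty, Set.ncard_empty]
    push_cast; ring
  | cons p l =>
    simp only [PartialHull.insert, PartialHull.totalWeight, pocketWeight, List.map_cons,
      List.sum_cons]
    ring

theorem PartialHull.numPoints_insert (a b : Pt) (pts : List Pt) (P : PartialHull) :
    numPoints (P.insert a b pts).active = numPoints P.active + pts.length := by
  cases pts with
  | nil => simp [PartialHull.insert]
  | cons p l =>
    simp only [PartialHull.insert, numPoints, List.map_cons, List.sum_cons]
    ring

theorem PartialHull.Good.insert {S : Set Pt} {a b : Pt} {pts : List Pt}
    (h : IsPocket S a b pts) (hpts : pts.Nodup) {P : PartialHull} (hP : P.Good S) :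
    (P.insert a b pts).Good S := by
  cases pts with
  | nil =>
    refine ⟨hP.active, ?_⟩
    intro e he
    rcases List.mem_cons.1 he with rfl | he
    · exact h
    · exact hP.done e he
  | cons p l =>
    refine ⟨?_, hP.done⟩
    intro e he
    rcases List.mem_cons.1 he with rfl | he
    · exact ⟨by simp, hpts, h⟩
    · exact hP.active e he

/-- `P'` arises from the partial hull `P` by inserting the edges that replace the edges of the
pockets `l`. -/
structure Refines (S : Set Pt) (l : List Pocket) (P P' : PartialHull) : Prop where
  good : P'.Good S
  points_le : P'.points ≤ P.points + pocketPoints l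
  totalWeight_eq : P'.totalWeight S = P.totalWeight S + pocketWeight S l
  numPoints_le : numPoints P'.active ≤ numPoints P.active + numPoints l
  two_mul_numPoints_le : latticeHull S = S →
    2 * numPoints P'.active ≤ 2 * numPoints P.active + numPoints l

/-- The new start points d₁, d₂ and the two lists of survivors are disjoint parts of the old pocket.
This invariant keeps all start points distinct, which is what bounds the number of edges at the end.
-/
theorem IsPocket.points_le {S : Set Pt} (hS : S.Finite) {a b d₁ d₂ : Pt} {l : List Pt}
    (h : IsPocket S a b l) (hl : l.Nodup) (hd : IsFarthest a b d₁ d₂ l) :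
    ((l.filter fun p => 0 < orient a d₁ p : List Pt) : Multiset Pt) +
      (if d₁ = d₂ then 0 else {d₁}) +
      d₂ ::ₘ ((l.filter fun p => 0 < orient d₂ b p : List Pt) : Multiset Pt) ≤ l := by
  have hanti : d₁ ≠ d₂ → orient d₂ b d₁ < 0 ∧ orient a d₁ d₂ < 0 := by
    intro hne
    obtain ⟨h1, h2⟩ := h.orient_last_pos hd hne
    have e1 : orient d₂ b d₁ = - orient d₁ b d₂ := by simp only [orient]; ring
    have e2 : orient a d₁ d₂ = - orient a d₂ d₁ := by simp only [orient]; ring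
    omega
  have n1 : d₁ ∉ l.filter fun p => 0 < orient a d₁ p := by simp [orient_self_right]
  have n2 : d₂ ∉ l.filter fun p => 0 < orient d₂ b p := by simp [orient_self_left]
  have n3 : d₂ ∉ l.filter fun p => 0 < orient a d₁ p := by
    by_cases hne : d₁ = d₂
    · rwa [← hne]
    · have := (hanti hne).2
      simp only [List.mem_filter, decide_eq_true_eq]; omega
  have n4 : d₁ ∉ l.filter fun p => 0 < orient d₂ b p := by
    by_cases hne : d₁ = d₂
    · rwa [hne]
    · have := (hanti hne).1
      simp only [List.mem_filter, decide_eq_true_eq]; omega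
  have n5 : ∀ s ∈ l.filter fun p => 0 < orient a d₁ p,
      s ∉ l.filter fun p => 0 < orient d₂ b p := by
    intro s hs hs'
    simp only [List.mem_filter, decide_eq_true_eq] at hs hs'
    have := h.disjoint hS hd (subset_latticeHull S ((h.mem_iff s).1 hs.1).1) hs.2
    omega
  have l1 := hl.filter fun p => 0 < orient a d₁ p
  have l2 := hl.filter fun p => 0 < orient d₂ b p
  have m1 := hd.mem_left
  have m2 := hd.mem_right
  have s1 := fun s (hs : s ∈ l.filter fun p => 0 < orient a d₁ p) => List.mem_of_mem_filter hs
  have s2 := fun s (hs : s ∈ l.filter fun p => 0 < orient d₂ b p) => List.mem_of_mem_filter hs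
  generalize (l.filter fun p => 0 < orient a d₁ p) = A at *
  generalize (l.filter fun p => 0 < orient d₂ b p) = B at *
  rw [Multiset.le_iff_subset]
  · intro x hx
    simp only [Multiset.mem_add, Multiset.mem_coe, Multiset.mem_cons] at hx ⊢
    rcases hx with (hx | hx) | hx | hx
    · exact s1 x hx
    · split_ifs at hx
      · simp at hx
      · rw [Multiset.mem_singleton] at hx; rwa [hx]
    · rwa [hx]
    · exact s2 x hx
  · rw [Multiset.nodup_add, Multiset.nodup_add, Multiset.nodup_cons]
    refine ⟨⟨l1, ?_, ?_⟩, ⟨n2, l2⟩, ?_⟩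
    · split_ifs <;> simp
    · rw [Multiset.disjoint_left]
      intro x hx hx'
      split_ifs at hx'
      · simp at hx'
      · rw [Multiset.mem_singleton] at hx'
        exact n1 (hx' ▸ hx)
    · rw [Multiset.disjoint_left]
      intro x hx hx'
      simp only [Multiset.mem_add, Multiset.mem_coe, Multiset.mem_cons] at hx hx'
      rcases hx with hx | hx
      · rcases hx' with hx' | hx'
        · exact n3 (hx' ▸ hx)
        · exact n5 x hx hx'
      · split_ifs at hx with hne
        · simp at hx
        · rw [Multiset.mem_singleton] at hx
          subst hx
          rcases hx' with hx' | hx'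
          · exact hne hx'
          · exact n4 hx'

theorem splitEdge_val {a b : Pt} {l : List Pt} (hl : l ≠ []) :
    ∃ d₁ d₂, IsFarthest a b d₁ d₂ l ∧ ∀ P, (splitEdge a b l P).val =
      PartialHull.insert d₂ b (l.filter fun p => 0 < orient d₂ b p)
        (if d₁ = d₂ then P.insert a d₁ (l.filter fun p => 0 < orient a d₁ p)
          else (P.insert a d₁ (l.filter fun p => 0 < orient a d₁ p)).insert d₁ d₂ []) := by
  obtain ⟨p, l, rfl⟩ := List.exists_cons_of_ne_nil hl
  refine ⟨_, _, (IsFarthest.singleton a b p).farthest l, fun P => ?_⟩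
  simp only [splitEdge, Timed.val_bind, outside_val, insertEdge_val, insertTopEdge_val, side_val]

theorem splitEdge_cost (a b : Pt) {l : List Pt} (hl : l ≠ []) (P : PartialHull) :
    (splitEdge a b l P).cost ≤ 66 * l.length := by
  obtain ⟨p, l, rfl⟩ := List.exists_cons_of_ne_nil hl
  simp only [splitEdge, Timed.cost_bind, side_cost, side_val, tick_cost, insertEdge_cost,
    insertEdge_val]
  have h1 := farthest_cost a b (orient a b p) p p l
  generalize DigitalConvexity.farthest a b (orient a b p) p p l = D at *
  have h2 := outside_cost a D.val.1 (p :: l)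
  have h3 := outside_cost D.val.2 b (p :: l)
  have h4 := insertTopEdge_cost D.val.1 D.val.2 (P.insert a D.val.1 (outside a D.val.1 (p :: l)).val)
  simp only [List.length_cons] at *
  omega

theorem Refines.splitEdge {S : Set Pt} (hS : S.Finite) {a b : Pt} {l : List Pt} (hne : l ≠ [])
    (hl : l.Nodup) (h : IsPocket S a b l) {P : PartialHull} (hP : P.Good S) :
    Refines S [⟨a, b, l⟩] P (splitEdge a b l P).val := by
  obtain ⟨d₁, d₂, hd, hval⟩ := splitEdge_val (a := a) (b := b) hne
  rw [hval]
  have hL := h.left hS hd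
  have hR := h.right hS hd
  have hle := h.points_le hS hl hd
  have hw := h.weight_split hS hd
  have hhalf := fun hdc => h.two_mul_le hS hdc hl hd
  have l1 := hl.filter fun p => 0 < orient a d₁ p
  have l2 := hl.filter fun p => 0 < orient d₂ b p
  generalize (l.filter fun p => 0 < orient a d₁ p) = A at *
  generalize (l.filter fun p => 0 < orient d₂ b p) = B at *
  set Q := P.insert a d₁ A with hQ
  have hQg : Q.Good S := hP.insert hL l1
  set Q' := if d₁ = d₂ then Q else Q.insert d₁ d₂ [] with hQ'
  have hQ'g : Q'.Good S := by
    rw [hQ']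
    split_ifs with hd12
    · exact hQg
    · exact hQg.insert (h.top hS hd hd12) List.nodup_nil
  have hQ'p : Q'.points = Q.points + if d₁ = d₂ then 0 else {d₁} := by
    rw [hQ']
    split_ifs with hd12
    · simp
    · rw [PartialHull.points_insert]; rfl
  have hQ'w : Q'.totalWeight S = Q.totalWeight S + if d₁ = d₂ then 0 else
      weight d₁ d₂ + 2 * ((outer S d₁ d₂).ncard : ℤ) := by
    rw [hQ']
    split_ifs with hd12
    · simp
    · rw [PartialHull.totalWeight_insert (h.top hS hd hd12)]
  have hQ'n : numPoints Q'.active = numPoints Q.active := by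
    rw [hQ']
    split_ifs with hd12
    · rfl
    · rw [PartialHull.numPoints_insert]; rfl
  have hn : numPoints (Q'.insert d₂ b B).active = numPoints P.active + A.length + B.length := by
    rw [PartialHull.numPoints_insert, hQ'n, hQ, PartialHull.numPoints_insert]
  refine ⟨hQ'g.insert hR l2, ?_, ?_, ?_, ?_⟩
  · rw [PartialHull.points_insert, hQ'p, hQ, PartialHull.points_insert]
    simp only [pocketPoints, List.map_cons, List.map_nil, List.sum_cons, List.sum_nil, add_zero]
    rw [add_assoc, add_assoc, add_le_add_iff_left, Multiset.cons_add, ← add_assoc]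
    exact Multiset.cons_le_cons a hle
  · rw [PartialHull.totalWeight_insert hR, hQ'w, hQ, PartialHull.totalWeight_insert hL]
    simp only [pocketWeight, List.map_cons, List.map_nil, List.sum_cons, List.sum_nil, add_zero]
    rw [hw]; ring
  · have hc := Multiset.card_le_card hle
    simp only [Multiset.card_add, Multiset.card_cons, Multiset.coe_card] at hc
    rw [hn]
    simp only [numPoints, List.map_cons, List.map_nil, List.sum_cons, List.sum_nil]
    omega
  · intro hdc
    have := hhalf hdc
    rw [hn]
    simp only [numPoints, List.map_cons, List.map_nil, List.sum_cons, List.sum_nil]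
    omega

theorem Refines.splitEdges {S : Set Pt} (hS : S.Finite) {l : List Pocket}
    (hl : GoodPockets S l) {P : PartialHull} (hP : P.Good S) :
    Refines S l P (splitEdges l P).val := by
  induction l generalizing P with
  | nil => exact ⟨hP, by simp [DigitalConvexity.splitEdges, pocketPoints],
      by simp [DigitalConvexity.splitEdges, pocketWeight],
      by simp [DigitalConvexity.splitEdges], by simp [DigitalConvexity.splitEdges]⟩
  | cons e l ih =>
    obtain ⟨h1, h2, h3⟩ := hl e List.mem_cons_self
    have r1 := Refines.splitEdge hS h1 h2 h3 hP
    have r2 := ih (fun e he => hl e (List.mem_cons_of_mem _ he)) r1.good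
    simp only [DigitalConvexity.splitEdges, Timed.val_bind]
    obtain ⟨-, a1, a2, a3, a4⟩ := r1
    obtain ⟨b0, b1, b2, b3, b4⟩ := r2
    simp only [pocketPoints, pocketWeight, numPoints, List.map_cons, List.map_nil, List.sum_cons,
      List.sum_nil, add_zero] at *
    refine ⟨b0, ?_, ?_, ?_, ?_⟩
    · refine b1.trans ?_
      rw [pocketPoints, List.map_cons, List.sum_cons, ← add_assoc]
      exact add_le_add_left a1 _
    · rw [b2, a2, pocketWeight, List.map_cons, List.sum_cons]; ring
    · simp only [numPoints, List.map_cons, List.sum_cons]; omega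
    · intro hdc
      have := a4 hdc
      have := b4 hdc
      simp only [numPoints, List.map_cons, List.sum_cons]; omega

theorem splitEdges_cost {l : List Pocket} (hl : ∀ e ∈ l, e.pts ≠ []) (P : PartialHull) :
    (splitEdges l P).cost ≤ 67 * numPoints l + 1 := by
  induction l generalizing P with
  | nil => simp [splitEdges]
  | cons e l ih =>
    have h0 := hl e List.mem_cons_self
    have h1 := splitEdge_cost e.a e.b h0 P
    have h2 := ih (fun e he => hl e (List.mem_cons_of_mem _ he)) (splitEdge e.a e.b e.pts P).val
    have h3 := List.length_pos_of_ne_nil h0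
    simp only [splitEdges, Timed.cost_bind, tick_cost, numPoints, List.map_cons,
      List.sum_cons] at *
    omega

/-- One step of QuickHull preserves the invariants. -/
theorem quickhullStep_spec {S : Set Pt} (hS : S.Finite) {P : PartialHull} (hP : P.Good S) :
    (quickhullStep P).val.Good S ∧ (quickhullStep P).val.points ≤ P.points ∧
      (quickhullStep P).val.totalWeight S = P.totalWeight S ∧
      numPoints (quickhullStep P).val.active ≤ numPoints P.active ∧
      (latticeHull S = S → 2 * numPoints (quickhullStep P).val.active ≤ numPoints P.active) ∧
      (quickhullStep P).cost ≤ 67 * numPoints P.active + 1 := by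
  have h0 : PartialHull.Good S ⟨[], P.done⟩ := ⟨by simp [GoodPockets], hP.done⟩
  obtain ⟨h1, h2, h3, h4, h5⟩ := Refines.splitEdges hS hP.active h0
  refine ⟨h1, ?_, ?_, ?_, ?_, splitEdges_cost (fun e he => (hP.active e he).1) _⟩
  · refine h2.trans_eq ?_
    simp [PartialHull.points, pocketPoints]
  · refine h3.trans ?_
    simp [PartialHull.totalWeight, pocketWeight]
  · simpa [numPoints, quickhullStep] using h4
  · simpa [numPoints, quickhullStep] using h5

/-- The edges `H` are those of the convex hull. -/
structure IsHull (S : Set Pt) (H : List Edge) (M : Multiset Pt) (w : ℤ) : Prop where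
  isPocket : ∀ e ∈ H, IsPocket S e.1 e.2 []
  starts_le : ((H.map Prod.fst : List Pt) : Multiset Pt) ≤ M
  weight_eq : (H.map fun e => weight e.1 e.2).sum = w

theorem quickhull_spec {S : Set Pt} (hS : S.Finite) (m : ℕ) {P : PartialHull} (hP : P.Good S)
    (hm : numPoints P.active = m) :
    (quickhull m P).cost ≤ 160 * m + 1 ∧
      ((quickhull m P).val = none → latticeHull S ≠ S) ∧
      ∀ H, (quickhull m P).val = some H → IsHull S H P.points (P.totalWeight S) := by
  induction m using Nat.strong_induction_on generalizing P with
  | _ m ih =>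
    rw [quickhull]
    simp only [Timed.cost_bind, Timed.val_bind, tick_cost]
    split_ifs with h0
    · subst h0
      have hact : P.active = [] := by
        rcases hA : P.active with _ | ⟨e, l⟩
        · rfl
        · exfalso
          have := List.length_pos_of_ne_nil (hP.active e (by simp [hA])).1
          simp only [numPoints, hA, List.map_cons, List.sum_cons] at hm
          omega
      refine ⟨by simp, by simp, ?_⟩
      rintro H hH
      simp only [Timed.val_pure, Option.some.injEq] at hH
      subst hH
      exact ⟨hP.done, by simp [PartialHull.points], by
        simp [PartialHull.totalWeight, hact, pocketWeight]⟩
    · obtain ⟨g1, g2, g3, g4, g5, g6⟩ := quickhullStep_spec hS hP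
      generalize quickhullStep P = R at *
      have hrem := remaining_val R.val.active
      have hremc := remaining_cost R.val.active fun e he => (g1.active e he).1
      simp only [Timed.cost_bind, Timed.val_bind, tick_cost, hrem]
      split_ifs with h1
      -- Since 2m' ≤ m, the costs 67m of the step, 5m' of the count and 160m' of the recursion sum
      -- to at most 149.5m, which leaves room for the constant terms as m ≥ 1.
      · obtain ⟨i1, i2, i3⟩ := ih (numPoints R.val.active) (by omega) g1 rfl
        refine ⟨by omega, i2, ?_⟩
        intro H hH
        obtain ⟨j1, j2, j3⟩ := i3 H hH
        exact ⟨j1, j2.trans g2, j3.trans g3⟩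
      · refine ⟨by simp only [Timed.cost_pure]; omega, ?_, by simp⟩
        intro _ hdc
        have := g5 hdc
        omega

/-! ### The initial hull -/

section Init

variable {S : Set Pt} {lo hi : Pt}

/-- `k` attains its minimum over `S` at `lo` only and its maximum at `hi` only. -/
theorem exists_separating_form (hS : S.Finite)
    (hlo : ∀ s ∈ S, lo.2 < s.2 ∨ lo.2 = s.2 ∧ lo.1 ≤ s.1)
    (hhi : ∀ s ∈ S, s.2 < hi.2 ∨ s.2 = hi.2 ∧ s.1 ≤ hi.1) :
    ∃ u v : ℤ, (∀ s ∈ S, s ≠ lo → u * lo.1 + v * lo.2 < u * s.1 + v * s.2) ∧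
      (∀ s ∈ S, s ≠ hi → u * s.1 + v * s.2 < u * hi.1 + v * hi.2) := by
  obtain ⟨N₁, h₁⟩ := IsCorner.of_lex hS (a := lo) 0 (-1) (-1) 0 (by
    intro s hs hne
    have h0 := hlo s hs
    have : ¬ (s.1 = lo.1 ∧ s.2 = lo.2) := fun h => hne (Prod.ext h.1 h.2)
    omega)
  obtain ⟨N₂, h₂⟩ := IsCorner.of_lex hS (a := hi) 0 1 1 0 (by
    intro s hs hne
    have h0 := hhi s hs
    have : ¬ (s.1 = hi.1 ∧ s.2 = hi.2) := fun h => hne (Prod.ext h.1 h.2)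
    omega)
  refine ⟨1, max N₁ N₂, fun s hs hne => ?_, fun s hs hne => ?_⟩
  · have := h₁ _ (le_max_left N₁ N₂) s hs hne
    linarith
  · have := h₂ _ (le_max_right N₁ N₂) s hs hne
    linarith

theorem isPocket_of_separating_form {a b : Pt} (ha : a ∈ S) (hb : b ∈ S) (hab : a ≠ b) {u v : ℤ}
    (hu : ∀ s ∈ S, s ≠ a → u * a.1 + v * a.2 < u * s.1 + v * s.2)
    (hv : ∀ s ∈ S, s ≠ b → u * s.1 + v * s.2 < u * b.1 + v * b.2)
    {pts : List Pt} (hpts : ∀ s, s ∈ pts ↔ s ∈ S ∧ 0 < orient a b s) : IsPocket S a b pts where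
  ne := hab
  mem_left := ha
  mem_right := hb
  corner_left := ⟨-u, -v, fun s hs hne => by have := hu s hs hne; linarith⟩
  corner_right := ⟨u, v, hv⟩
  mem_iff := hpts
  strip := by
    have h1 : ∀ s ∈ pts, s ≠ a ∧ s ≠ b := fun s hs =>
      (ne_of_orient_pos ((hpts s).1 hs).2).2
    have h2 : ∀ s ∈ pts, s ∈ S := fun s hs => ((hpts s).1 hs).1
    exact ⟨u, v, hu b hb hab.symm, fun s hs => ⟨(hu s (h2 s hs) (h1 s hs).1).le,
      (hv s (h2 s hs) (h1 s hs).2).le⟩, Or.inl fun s hs => hu s (h2 s hs) (h1 s hs).1⟩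

theorem orient_swap (a b x : Pt) : orient b a x = -orient a b x := by
  simp only [orient]; ring

/-- Pick's formula, with the two pockets of a diagonal of the hull. -/
theorem two_mul_ncard_latticeHull (hS : S.Finite) {a b : Pt} (ha : a ∈ S) (hb : b ∈ S)
    (hab : a ≠ b) {u v : ℤ}
    (hu : ∀ s ∈ S, s ≠ a → u * a.1 + v * a.2 < u * s.1 + v * s.2)
    (hv : ∀ s ∈ S, s ≠ b → u * s.1 + v * s.2 < u * b.1 + v * b.2) :
    (weight a b + 2 * ((outer S a b).ncard : ℤ)) + (weight b a + 2 * ((outer S b a).ncard : ℤ)) =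
      2 * ((latticeHull S).ncard : ℤ) - 2 := by
  set φ : Pt → ℤ := fun x => u * x.1 + v * x.2 - (u * a.1 + v * a.2) with hφ
  have hφa : φ a = 0 := by simp [hφ]
  have hφb : 0 < φ b := by have := hu b hb hab.symm; simp only [hφ]; omega
  have hseg := (ncard_segment a b u v (-(u * a.1 + v * a.2)) φ
    (fun x => by simp only [hφ]; ring) hφa hφb).2.1
  set E := {x | orient a b x = 0 ∧ 0 ≤ φ x ∧ φ x ≤ φ b} with hE
  have hEsub : E ⊆ latticeHull S := by
    rintro x ⟨h1, h2, h3⟩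
    refine mem_latticeHull_of_combination ha hb hb (k₁ := φ b - φ x) (k₂ := φ x) (k₃ := 0)
      (by omega) h2 le_rfl (by omega) ?_ ?_
    · simp only [hφ, orient] at h1 ⊢
      linear_combination v * h1
    · simp only [hφ, orient] at h1 ⊢
      linear_combination (-u) * h1
  have hfin := finite_latticeHull hS
  have e : latticeHull S = (outer S a b ∪ outer S b a) ∪ E := by
    ext x
    constructor
    · intro hx
      rcases lt_trichotomy (orient a b x) 0 with h | h | h
      · exact Or.inl (Or.inr ⟨hx, by rw [orient_swap]; omega⟩)
      · refine Or.inr ⟨h, ?_, ?_⟩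
        · have := IsCorner.le (a := a) (u := -u) (v := -v) hx
            (fun s hs hne => by have := hu s hs hne; linarith)
          simp only [hφ]; linarith
        · have := IsCorner.le hx hv
          simp only [hφ]; linarith
      · exact Or.inl (Or.inl ⟨hx, h⟩)
    · rintro ((hx | hx) | hx)
      · exact hx.1
      · exact hx.1
      · exact hEsub hx
  have hc : (latticeHull S).ncard = (outer S a b).ncard + (outer S b a).ncard + E.ncard := by
    conv_lhs => rw [e]
    rw [Set.ncard_union_eq _ ((outer_finite hS a b).union (outer_finite hS b a))
      (hfin.subset hEsub), Set.ncard_union_eq _ (outer_finite hS a b) (outer_finite hS b a)]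
    · rw [Set.disjoint_left]
      intro x hx hx'
      have h1 := hx.2
      have h2 := hx'.2
      rw [orient_swap] at h2
      omega
    · rw [Set.disjoint_left]
      rintro x (hx | hx) hx'
      · have h1 := hx.2
        have h2 := hx'.1
        omega
      · have h1 := hx.2
        have h2 := hx'.1
        rw [orient_swap] at h1
        omega
  have hw : weight a b + weight b a =
      2 * (Nat.gcd (b.1 - a.1).natAbs (b.2 - a.2).natAbs : ℕ) := by
    have h1 : (a.1 - b.1).natAbs = (b.1 - a.1).natAbs := by omega
    have h2 : (a.2 - b.2).natAbs = (b.2 - a.2).natAbs := by omega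
    simp only [weight, h1, h2]
    ring
  rw [hc, hseg]
  push_cast
  linarith

end Init

theorem quickhullInit_spec {p : Pt} {l : List Pt} (hnd : (p :: l).Nodup)
    (hne : (bottom p l).val ≠ (top p l).val) :
    (quickhullInit p l).val.Good {s | s ∈ p :: l} ∧
      (quickhullInit p l).val.points ≤ (p :: l : List Pt) ∧
      (quickhullInit p l).val.totalWeight {s | s ∈ p :: l} =
        2 * ((latticeHull {s | s ∈ p :: l}).ncard : ℤ) - 2 ∧
      (quickhullInit p l).cost ≤ 100 * (p :: l).length + 10 := by
  have hS : {s | s ∈ p :: l}.Finite := List.finite_toSet (p :: l)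
  obtain ⟨hlo, hlo'⟩ := bottom_spec p l
  obtain ⟨hhi, hhi'⟩ := top_spec p l
  have cb := bottom_cost p l
  have ct := top_cost p l
  have c1 := outside_cost (bottom p l).val (top p l).val (p :: l)
  have c2 := outside_cost (top p l).val (bottom p l).val (p :: l)
  simp only [quickhullInit, Timed.val_bind, Timed.cost_bind, outside_val, insertEdge_val,
    insertEdge_cost]
  generalize (bottom p l).val = lo at *
  generalize (top p l).val = hi at *
  have hlen : l.length + 1 = (p :: l).length := rfl
  generalize p :: l = L at *
  set S : Set Pt := {s | s ∈ L} with hSd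
  obtain ⟨u, v, hu, hv⟩ := exists_separating_form hS hlo' hhi'
  set R := L.filter fun s => 0 < orient lo hi s with hR
  set R' := L.filter fun s => 0 < orient hi lo s with hR'
  have p1 : IsPocket S lo hi R := isPocket_of_separating_form hlo hhi hne hu hv
    (by simp [hR, hSd])
  have p2 : IsPocket S hi lo R' := isPocket_of_separating_form (u := -u) (v := -v) hhi hlo
    hne.symm (fun s hs hn => by have := hv s hs hn; linarith)
    (fun s hs hn => by have := hu s hs hn; linarith) (by simp [hR', hSd])
  have n1 : R.Nodup := hnd.filter _
  have n2 : R'.Nodup := hnd.filter _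
  have g0 : PartialHull.Good S ⟨[], []⟩ := ⟨by simp [GoodPockets], by simp⟩
  have g2 := (g0.insert p1 n1).insert p2 n2
  obtain ⟨s1, s2, s3, s4, s5, s6⟩ := quickhullStep_spec hS g2
  have hpts : (((⟨[], []⟩ : PartialHull).insert lo hi R).insert hi lo R').points ≤
      (L : Multiset Pt) := by
    have m1 : ∀ s ∈ R, s ∈ L ∧ 0 < orient lo hi s := fun s hs => by simpa [hR] using hs
    have m2 : ∀ s ∈ R', s ∈ L ∧ 0 < orient hi lo s := fun s hs => by simpa [hR'] using hs
    have z1 : ∀ s ∈ R, s ≠ lo ∧ s ≠ hi := fun s hs => (ne_of_orient_pos (m1 s hs).2).2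
    have z2 : ∀ s ∈ R', s ≠ hi ∧ s ≠ lo := fun s hs => (ne_of_orient_pos (m2 s hs).2).2
    rw [PartialHull.points_insert, PartialHull.points_insert]
    simp only [PartialHull.points, pocketPoints, List.map_nil, List.sum_nil, Multiset.coe_nil,
      zero_add, add_zero]
    rw [Multiset.le_iff_subset]
    · intro x hx
      simp only [Multiset.mem_add, Multiset.mem_coe, Multiset.mem_cons] at hx ⊢
      rcases hx with (rfl | hx) | rfl | hx
      · exact hlo
      · exact (m1 x hx).1
      · exact hhi
      · exact (m2 x hx).1
    · rw [Multiset.nodup_add, Multiset.nodup_cons, Multiset.nodup_cons, Multiset.disjoint_left]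
      refine ⟨⟨fun h => (z1 _ h).1 rfl, n1⟩, ⟨fun h => (z2 _ h).1 rfl, n2⟩, ?_⟩
      intro x hx hx'
      simp only [Multiset.mem_coe, Multiset.mem_cons] at hx hx'
      rcases hx with rfl | hx <;> rcases hx' with h | hx'
      · exact hne h
      · exact (z2 _ hx').2 rfl
      · exact (z1 _ hx).2 h
      · have h1 := (m1 x hx).2
        have h2 := (m2 x hx').2
        rw [orient_swap] at h2
        omega
  have hnum : numPoints (((⟨[], []⟩ : PartialHull).insert lo hi R).insert hi lo R').active ≤
      L.length := by
    have h1 := Multiset.card_le_card hpts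
    rw [PartialHull.points_insert, PartialHull.points_insert] at h1
    rw [PartialHull.numPoints_insert, PartialHull.numPoints_insert]
    simp only [PartialHull.points, pocketPoints, numPoints, List.map_nil, List.sum_nil,
      Multiset.coe_nil, Multiset.card_add, Multiset.card_cons, Multiset.coe_card,
      Multiset.card_zero] at h1 ⊢
    omega
  refine ⟨s1, s2.trans hpts, ?_, by omega⟩
  rw [s3, PartialHull.totalWeight_insert p2, PartialHull.totalWeight_insert p1,
    ← two_mul_ncard_latticeHull hS hlo hhi hne hu hv]
  simp [PartialHull.totalWeight, pocketWeight]

/-! ### Counting -/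

theorem pickSums_val (H : List Edge) :
    (pickSums H).val.1 + (pickSums H).val.2 = (H.map fun e => weight e.1 e.2).sum := by
  induction H with
  | nil => rfl
  | cons e H ih =>
    obtain ⟨a, b⟩ := e
    change (a.1 * b.2 - a.2 * b.1 + (pickSums H).val.1) +
      (((euclid (b.1 - a.1).natAbs (b.2 - a.2).natAbs).val : ℕ) + (pickSums H).val.2) =
        weight a b + (H.map fun e => weight e.1 e.2).sum
    rw [← ih, euclid_val, weight]
    ring

theorem latticeCount_val (H : List Edge) :
    (latticeCount H).val = (H.map fun e => weight e.1 e.2).sum / 2 + 1 := by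
  rw [← pickSums_val]
  rfl

/-- Two rounds, which cost 4 units, at least halve the second argument. The factor 2 inside the
logarithm separates y = 0 from y = 1 and thus pays for the last round. -/
theorem euclid_cost (x y : ℕ) : (euclid x y).cost ≤ 4 * Nat.log 2 (2 * y) + 1 := by
  induction y using Nat.strong_induction_on generalizing x with
  | _ y ih =>
    rw [euclid]
    simp only [Timed.cost_bind, tick_cost]
    split_ifs with h
    · simp
    · simp only [Timed.cost_bind, tick_cost]
      have hy := Nat.pos_of_ne_zero h
      have hlog : Nat.log 2 (2 * y) = Nat.log 2 y + 1 := by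
        rw [mul_comm]; exact Nat.log_mul_base one_lt_two h
      have hr := Nat.mod_lt x hy
      generalize x % y = r at *
      rw [euclid]
      simp only [Timed.cost_bind, tick_cost]
      split_ifs with h0
      · simp; omega
      · have hr0 := Nat.pos_of_ne_zero h0
        have h1 := Nat.mod_lt y hr0
        have h2 := ih (y % r) (h1.trans hr) r
        -- The quotient is at least 1, so y is at least r + y % r, and r exceeds y % r.
        have h3 : 2 * (y % r) ≤ y := by
          have := Nat.div_add_mod y r
          have h4 : 1 ≤ y / r := Nat.div_pos hr.le hr0
          nlinarith
        have h5 := Nat.log_mono_right (b := 2) h3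
        simp only [Timed.cost_bind, tick_cost]
        omega

theorem latticeCount_cost {H : List Edge} {B : ℝ}
    (hB : ∀ e ∈ H, (Nat.log 2 (2 * (e.2.2 - e.1.2).natAbs) : ℝ) ≤ B) :
    ((latticeCount H).cost : ℝ) ≤ H.length * (11 + 4 * B) + 4 := by
  have key : ((pickSums H).cost : ℝ) ≤ H.length * (11 + 4 * B) + 1 := by
    induction H with
    | nil => simp [pickSums]
    | cons e H ih =>
      have h1 := ih fun e he => hB e (List.mem_cons_of_mem _ he)
      have h2 := hB e List.mem_cons_self
      obtain ⟨a, b⟩ := e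
      have h3 : (pickSums ((a, b) :: H)).cost =
          10 + (euclid (b.1 - a.1).natAbs (b.2 - a.2).natAbs).cost + (pickSums H).cost := by
        change 1 + (1 + (1 + (1 + (1 + (1 + (1 + (1 +
          ((euclid (b.1 - a.1).natAbs (b.2 - a.2).natAbs).cost +
            ((pickSums H).cost + (1 + (1 + 0))))))))))) = _
        ring
      have h4 : ((euclid (b.1 - a.1).natAbs (b.2 - a.2).natAbs).cost : ℝ) ≤
          4 * (Nat.log 2 (2 * (b.2 - a.2).natAbs) : ℝ) + 1 := by
        exact_mod_cast euclid_cost _ _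
      rw [h3]
      push_cast [List.length_cons]
      simp only at h2
      linarith
  have : (latticeCount H).cost = (pickSums H).cost + 3 := rfl
  rw [this]
  push_cast
  linarith

/-! ### The edges of the hull -/

/-- An edge is the closed convex hull of its extreme points, which are also extreme in conv(S) and
hence images of points of S. Finiteness matters because `ncard` would be zero on an infinite set. -/
theorem edges_conv_finite {S : Set Pt} (hS : S.Finite) : (edges (conv S)).Finite := by
  have hV : (toPlane '' S).Finite := hS.image _
  refine (hV.finite_subsets.image fun E => closure (convexHull ℝ E)).subset ?_
  rintro F ⟨hF, a, b, -, rfl⟩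
  refine ⟨(segment ℝ a b).extremePoints ℝ, ?_, ?_⟩
  · exact hF.isExtreme.extremePoints_subset_extremePoints.trans extremePoints_convexHull_subset
  · refine closure_convexHull_extremePoints ?_ (convex_segment a b)
    rw [← convexHull_pair]
    exact (Set.toFinite {a, b}).isCompact_convexHull ℝ

/-! ### Computed edges as exposed segments -/

section Edge

variable {S : Set Pt} {a b : Pt}

/-- On the line ab, the forms that make a and b corners bound the parameter of a hull point by 0 and
1. -/
theorem mem_segment_of_isPocket (h : IsPocket S a b []) {x : EuclideanSpace ℝ (Fin 2)}
    (hx : x ∈ conv S)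
    (ho : (x 0 - a.1) * ((b.2 : ℝ) - a.2) - (x 1 - a.2) * ((b.1 : ℝ) - a.1) = 0) :
    x ∈ segment ℝ (toPlane a) (toPlane b) := by
  obtain ⟨u, v, hu⟩ := h.corner_left
  obtain ⟨u', v', hu'⟩ := h.corner_right
  have hle : ∀ {c : Pt} {u v : ℤ}, (∀ s ∈ S, s ≠ c → u * s.1 + v * s.2 < u * c.1 + v * c.2) →
      (u : ℝ) * x 0 + v * x 1 ≤ u * c.1 + v * c.2 := by
    intro c u v huv
    refine conv_le hx fun s hs => ?_
    by_cases hsc : s = c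
    · rw [hsc]
    · exact_mod_cast (huv s hs hsc).le
  have k1 := hle hu
  have k2 := hle hu'
  have k3 : (u : ℝ) * b.1 + v * b.2 < u * a.1 + v * a.2 := by
    exact_mod_cast hu b h.mem_right h.ne.symm
  have k4 : (u' : ℝ) * a.1 + v' * a.2 < u' * b.1 + v' * b.2 := by
    exact_mod_cast hu' a h.mem_left h.ne
  set D : ℝ := ((b.1 : ℝ) - a.1) * (b.1 - a.1) + ((b.2 : ℝ) - a.2) * (b.2 - a.2) with hD
  have hDpos : 0 < D := by
    have := sq_dist_pos h.ne
    rw [hD]; exact_mod_cast this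
  set t : ℝ := ((x 0 - a.1) * (b.1 - a.1) + (x 1 - a.2) * (b.2 - a.2)) / D with ht
  have htD : t * D = (x 0 - a.1) * (b.1 - a.1) + (x 1 - a.2) * (b.2 - a.2) := by
    rw [ht]; field_simp
  have x0 : x 0 = a.1 + t * (b.1 - a.1) := by
    apply mul_left_cancel₀ hDpos.ne'
    linear_combination (b.2 - a.2 : ℝ) * ho - (b.1 - a.1 : ℝ) * htD
  have x1 : x 1 = a.2 + t * (b.2 - a.2) := by
    apply mul_left_cancel₀ hDpos.ne'
    linear_combination -(b.1 - a.1 : ℝ) * ho - (b.2 - a.2 : ℝ) * htD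
  have t0 : 0 ≤ t := by
    by_contra hneg
    rw [x0, x1] at k1
    nlinarith
  have t1 : t ≤ 1 := by
    by_contra hneg
    rw [x0, x1] at k2
    nlinarith
  refine ⟨1 - t, t, by linarith, t0, by ring, ?_⟩
  ext i
  fin_cases i
  · simp [toPlane, x0]; ring
  · simp [toPlane, x1]; ring

/-- With no point of S to the right of ab, the form `orient a b` is maximal over the hull on the
line ab, and it exposes the segment. -/
theorem IsPocket.segment_mem_edges (h : IsPocket S a b []) :
    segment ℝ (toPlane a) (toPlane b) ∈ edges (conv S) := by
  have hconv : Convex ℝ (conv S) := convex_convexHull ℝ _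
  have ha : toPlane a ∈ conv S := subset_latticeHull S h.mem_left
  have hb : toPlane b ∈ conv S := subset_latticeHull S h.mem_right
  refine ⟨fun _ => ?_, toPlane a, toPlane b, fun hab => h.ne (toPlane_injective hab), rfl⟩
  set φ : EuclideanSpace ℝ (Fin 2) →L[ℝ] ℝ :=
    ((b.2 : ℝ) - a.2) • EuclideanSpace.proj 0 - ((b.1 : ℝ) - a.1) • EuclideanSpace.proj 1 with hφ
  have hval : ∀ x, φ x = ((b.2 : ℝ) - a.2) * x 0 - ((b.1 : ℝ) - a.1) * x 1 := by
    intro x; simp [hφ]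
  have hmax : ∀ y ∈ conv S, φ y ≤ φ (toPlane a) := by
    intro y hy
    have := conv_le hy (u := (b.2 : ℝ) - a.2) (v := -((b.1 : ℝ) - a.1)) (c := φ (toPlane a)) (by
      intro s hs
      have h1 : ¬ (s ∈ S ∧ 0 < orient a b s) := fun hh => by simpa using (h.mem_iff s).2 hh
      have h2 : orient a b s ≤ 0 := not_lt.1 fun hh => h1 ⟨hs, hh⟩
      have h3 : ((orient a b s : ℤ) : ℝ) ≤ 0 := by exact_mod_cast h2
      rw [hval, toPlane_zero, toPlane_one]
      simp only [orient] at h3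
      push_cast at h3
      linarith)
    rw [hval y]
    linarith
  have hab : φ (toPlane b) = φ (toPlane a) := by
    rw [hval, hval]; simp only [toPlane_zero, toPlane_one]; ring
  refine ⟨φ, ?_⟩
  ext x
  constructor
  · intro hx
    refine ⟨hconv.segment_subset ha hb hx, fun y hy => (hmax y hy).trans_eq ?_⟩
    obtain ⟨s, t, -, -, hst, rfl⟩ := hx
    rw [map_add, map_smul, map_smul, hab, ← add_smul, hst, one_smul]
  · rintro ⟨hx, hxm⟩
    have e := le_antisymm (hmax x hx) (hxm _ ha)
    rw [hval, hval, toPlane_zero, toPlane_one] at e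
    exact mem_segment_of_isPocket h hx (by linarith)

/-- A corner is not an inner point of a segment. -/
theorem IsCorner.eq_or_eq {a b c : Pt} (hc : IsCorner S c) (ha : a ∈ S) (hb : b ∈ S)
    (h : toPlane c ∈ segment ℝ (toPlane a) (toPlane b)) : c = a ∨ c = b := by
  by_contra! hne
  obtain ⟨u, v, huv⟩ := hc
  have h1 : (u : ℝ) * a.1 + v * a.2 < u * c.1 + v * c.2 := by
    exact_mod_cast huv a ha hne.1.symm
  have h2 : (u : ℝ) * b.1 + v * b.2 < u * c.1 + v * c.2 := by
    exact_mod_cast huv b hb hne.2.symm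
  obtain ⟨s, t, hs, ht, hst, hx⟩ := h
  have e0 := congrArg (fun v : EuclideanSpace ℝ (Fin 2) => v 0) hx
  have e1 := congrArg (fun v : EuclideanSpace ℝ (Fin 2) => v 1) hx
  simp only [PiLp.add_apply, PiLp.smul_apply, toPlane_zero, toPlane_one, smul_eq_mul] at e0 e1
  rw [← e0, ← e1] at h1 h2
  have hs' : s = 1 - t := by linarith
  subst hs'
  rcases ht.eq_or_lt with rfl | ht'
  · nlinarith
  · rcases hs.eq_or_lt with hs'' | hs''
    · have : t = 1 := by linarith
      subst this
      nlinarith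
    · nlinarith [mul_lt_mul_of_pos_left h1 hs'', mul_lt_mul_of_pos_left h2 ht']

end Edge

/-- Directed edges with the same segment start at one of its two ends, since corners are not inner
points of segments. As start points are distinct, at most two directed edges share a segment. -/
theorem IsHull.length_le {S : Set Pt} (hS : S.Finite) {H : List Edge} {M : Multiset Pt} {w : ℤ}
    (h : IsHull S H M w) (hM : M.Nodup) : H.length ≤ 2 * numEdges S := by
  classical
  have hnd : (H.map Prod.fst).Nodup := Multiset.coe_nodup.1 (Multiset.nodup_of_le h.starts_le hM)
  have hinj := List.inj_on_of_nodup_map hnd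
  rw [← List.toFinset_card_of_nodup hnd.of_map]
  set σ : Edge → Set (EuclideanSpace ℝ (Fin 2)) :=
    fun e => segment ℝ (toPlane e.1) (toPlane e.2) with hσ
  have h1 := Finset.card_le_mul_card_image (f := σ) H.toFinset 2 (by
    intro F hF
    obtain ⟨e, he, rfl⟩ := Finset.mem_image.1 hF
    have hsub : ((H.toFinset.filter fun x => σ x = σ e).image Prod.fst) ⊆ {e.1, e.2} := by
      intro x hx
      obtain ⟨e', he', rfl⟩ := Finset.mem_image.1 hx
      obtain ⟨he', hee⟩ := Finset.mem_filter.1 he'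
      have p' := h.isPocket e' (List.mem_toFinset.1 he')
      have p := h.isPocket e (List.mem_toFinset.1 he)
      have hm : toPlane e'.1 ∈ σ e := hee ▸ left_mem_segment ℝ _ _
      have := p'.corner_left.eq_or_eq p.mem_left p.mem_right hm
      simpa using this
    rw [← Finset.card_image_of_injOn (f := Prod.fst)]
    · exact (Finset.card_le_card hsub).trans Finset.card_le_two
    · intro x hx y hy hxy
      simp only [Finset.coe_filter, List.mem_toFinset, Set.mem_ofPred_eq] at hx hy
      exact hinj hx.1 hy.1 hxy)
  refine h1.trans (Nat.mul_le_mul_left 2 ?_)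
  rw [← Set.ncard_coe_finset]
  refine Set.ncard_le_ncard ?_ (edges_conv_finite hS)
  intro F hF
  obtain ⟨e, he, rfl⟩ := Finset.mem_image.1 (Finset.mem_coe.1 hF)
  exact (h.isPocket e (List.mem_toFinset.1 he)).segment_mem_edges

/-! ### Diameter and logarithm estimates -/

theorem abs_sub_le_diameter {S : Set Pt} (hS : S.Finite) {a b : Pt} (ha : a ∈ S) (hb : b ∈ S) :
    |((b.1 - a.1 : ℤ) : ℝ)| ≤ diameter S ∧ |((b.2 - a.2 : ℤ) : ℝ)| ≤ diameter S := by
  have hd : dist (toPlane b) (toPlane a) ≤ diameter S :=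
    Metric.dist_le_diam_of_mem (hS.image _).isBounded ⟨b, hb, rfl⟩ ⟨a, ha, rfl⟩
  rw [dist_eq_norm] at hd
  have h0 := PiLp.norm_apply_le (toPlane b - toPlane a) 0
  have h1 := PiLp.norm_apply_le (toPlane b - toPlane a) 1
  rw [PiLp.sub_apply, Real.norm_eq_abs] at h0 h1
  simp only [toPlane_zero, toPlane_one] at h0 h1
  push_cast
  exact ⟨h0.trans hd, h1.trans hd⟩

theorem one_le_diameter {S : Set Pt} (hS : S.Finite) {a b : Pt} (ha : a ∈ S) (hb : b ∈ S)
    (hab : a ≠ b) : 1 ≤ diameter S := by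
  obtain ⟨h1, h2⟩ := abs_sub_le_diameter hS ha hb
  by_cases h : b.1 - a.1 = 0
  · have h' : b.2 - a.2 ≠ 0 := fun h' => hab (Prod.ext (by omega) (by omega))
    refine le_trans ?_ h2
    exact_mod_cast Int.one_le_abs h'
  · refine le_trans ?_ h1
    exact_mod_cast Int.one_le_abs h

/-- The factor 2 bounds 1 / log 2. -/
theorem natLog_le {n : ℕ} {r : ℝ} (hr : 1 ≤ r) (hn : (n : ℝ) ≤ r) :
    (Nat.log 2 (2 * n) : ℝ) ≤ 1 + 2 * Real.log r := by
  have hlr := Real.log_nonneg hr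
  rcases Nat.eq_zero_or_pos n with rfl | hpos
  · simp; linarith
  · have h1 : (2 : ℝ) ^ Nat.log 2 (2 * n) ≤ 2 * r := by
      have : ((2 ^ Nat.log 2 (2 * n) : ℕ) : ℝ) ≤ ((2 * n : ℕ) : ℝ) := by
        exact_mod_cast Nat.pow_log_le_self 2 (by omega)
      push_cast at this
      linarith
    have h2 := Real.log_le_log (by positivity) h1
    rw [Real.log_pow, Real.log_mul (by norm_num) (by linarith)] at h2
    have h3 : (1 / 2 : ℝ) < Real.log 2 := by have := Real.log_two_gt_d9; linarith
    have h4 : ((Nat.log 2 (2 * n) : ℝ) - 1) * Real.log 2 ≤ Real.log r := by linarith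
    by_contra hneg
    nlinarith

/-! ### The main theorem -/

theorem isDigitalConvex_nil : (isDigitalConvex []).val = true := rfl

theorem digitalConvex_empty : DigitalConvex ∅ := by
  simp [DigitalConvex, conv]

theorem digitalConvex_singleton (p : Pt) : DigitalConvex {p} := by
  simp [DigitalConvex, conv]

theorem isDigitalConvex_singleton (p : Pt) :
    (isDigitalConvex [p]).val = true ∧ (isDigitalConvex [p]).cost ≤ 200 := by
  have ho : orient p p p = 0 := by simp [orient]
  have hz : p.1 * p.2 - p.2 * p.1 = 0 := by ring
  have hq : ∀ P : PartialHull, quickhull 0 P = ⟨some P.done, 1⟩ := by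
    intro P; rw [quickhull]; rfl
  have he : ∀ x, euclid x 0 = ⟨x, 1⟩ := by
    intro x; rw [euclid]; rfl
  constructor
  · simp [isDigitalConvex, quickhullInit, quickhullStep, splitEdges, bottom, top, insertEdge_val,
      PartialHull.insert, ho, hq, remaining, latticeCount_val, weight, hz]
  · simp [isDigitalConvex, quickhullInit, quickhullStep, splitEdges, bottom, top, insertEdge_val,
      PartialHull.insert, ho, hq, remaining, insertEdge_cost, outside, length,
      latticeCount, pickSums, add, sub, mul, abs, half, he, hz]

theorem two_points {p q : Pt} {l : List Pt} (hnd : (p :: q :: l).Nodup) :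
    (bottom p (q :: l)).val ≠ (top p (q :: l)).val := by
  intro heq
  have hb := (bottom_spec p (q :: l)).2
  have ht := (top_spec p (q :: l)).2
  have b1 := hb p (by simp)
  have b2 := hb q (by simp)
  have t1 := ht p (by simp)
  have t2 := ht q (by simp)
  rw [heq] at b1 b2
  have : p = q := Prod.ext (by omega) (by omega)
  simp [this] at hnd

theorem isDigitalConvex_spec {L : List Pt} (hnd : L.Nodup) {p q : Pt} {l : List Pt}
    (hL : L = p :: q :: l) :
    ((isDigitalConvex L).val = true ↔ DigitalConvex {s | s ∈ L}) ∧
      ((isDigitalConvex L).cost : ℝ) ≤ 1000 * ((L.length : ℝ) +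
        (numEdges {s | s ∈ L} : ℝ) * Real.log (diameter {s | s ∈ L})) := by
  have hS : {s | s ∈ L}.Finite := List.finite_toSet L
  obtain ⟨g1, g2, g3, g4⟩ := hL ▸ quickhullInit_spec (hL ▸ hnd) (two_points (hL ▸ hnd))
  have hlen : (length L).val = L.length := length_val L
  have hlenc := length_cost L
  have hdef : isDigitalConvex L = (do
      tick
      let n ← length L
      let P ← quickhullInit p (q :: l)
      let m ← remaining P.active
      match ← quickhull m P with
      | none => return false
      | some H => do
        let c ← latticeCount H
        if ← lt n c then return false else return true) := by subst hL; rfl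
  rw [hdef]
  generalize quickhullInit p (q :: l) = R at *
  have hpq : p ∈ {s | s ∈ L} ∧ q ∈ {s | s ∈ L} ∧ p ≠ q := by
    subst hL
    refine ⟨by simp, by simp, ?_⟩
    rintro rfl
    simp at hnd
  have hr : 1 ≤ diameter {s | s ∈ L} := one_le_diameter hS hpq.1 hpq.2.1 hpq.2.2
  have hcard : {s | s ∈ L}.ncard = L.length := by
    classical
    rw [← List.toFinset_card_of_nodup hnd, ← Set.ncard_coe_finset]
    congr 1
    ext; simp
  have hsub := subset_latticeHull {s | s ∈ L}
  have hfin := finite_latticeHull hS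
  have hmn : numPoints R.val.active ≤ L.length := by
    have h1 := Multiset.card_le_card g2
    simp only [PartialHull.points, Multiset.card_add, Multiset.coe_card] at h1
    have h2 : numPoints R.val.active ≤ Multiset.card (pocketPoints R.val.active) := by
      generalize R.val.active = A
      induction A with
      | nil => simp [numPoints]
      | cons e A ih =>
        simp only [numPoints, pocketPoints, List.map_cons, List.sum_cons, Multiset.card_add,
          Multiset.card_cons, Multiset.coe_card] at *
        omega
    omega
  have hlen2 : 2 ≤ L.length := by subst hL; simp
  have hrem := remaining_val R.val.active
  have hremc := remaining_cost R.val.active fun e he => (g1.active e he).1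
  obtain ⟨q1, q2, q3⟩ := quickhull_spec hS _ g1 rfl
  rw [← hrem] at q1 q2 q3
  simp only [Timed.val_bind, Timed.cost_bind, tick_cost, hlen]
  have hlr := Real.log_nonneg hr
  generalize {s | s ∈ L} = S at *
  generalize (remaining R.val.active) = m at *
  generalize quickhull m.val R.val = Q at *
  have hh : (0 : ℝ) ≤ numEdges S * Real.log (diameter S) := by positivity
  have hbase : (1 + ((length L).cost + (R.cost + (m.cost + Q.cost)))) ≤ 300 * L.length := by
    omega
  rcases hQ : Q.val with _ | H
  · refine ⟨?_, ?_⟩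
    · simp [digitalConvex_iff, q2 hQ]
    · simp only [Timed.cost_pure, add_zero]
      have : ((1 + ((length L).cost + (R.cost + (m.cost + Q.cost))) : ℕ) : ℝ) ≤
          ((300 * L.length : ℕ) : ℝ) := by exact_mod_cast hbase
      push_cast at this ⊢
      have : (0 : ℝ) ≤ L.length := by positivity
      linarith
  · have hH := q3 H hQ
    have hM : R.val.points.Nodup := Multiset.nodup_of_le g2 (Multiset.coe_nodup.2 hnd)
    have hHe := hH.length_le hS hM
    have hHn : H.length ≤ L.length := by
      have h1 := Multiset.card_le_card (hH.starts_le.trans g2)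
      simpa using h1
    -- The weights sum to the even number 2N - 2, so halving it loses nothing.
    have hcount : (latticeCount H).val = (latticeHull S).ncard := by
      rw [latticeCount_val, hH.weight_eq, g3]
      omega
    refine ⟨?_, ?_⟩
    · simp only [Timed.val_bind, lt_val, Timed.val_ite, Timed.val_pure, decide_eq_true_eq, hcount,
        digitalConvex_iff]
      rw [ite_eq_right_iff]
      simp only [Bool.false_eq_true, imp_false, not_lt]
      rw [← hcard]
      constructor
      · intro hle
        exact (Set.eq_of_subset_of_ncard_le hsub (by exact_mod_cast hle) hfin).symm
      · intro heq
        rw [heq]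
    · have hcost := latticeCount_cost (H := H) (B := 1 + 2 * Real.log (diameter S)) (by
        intro e he
        have hp := hH.isPocket e he
        apply natLog_le hr
        have := (abs_sub_le_diameter hS hp.mem_left hp.mem_right).2
        rwa [Nat.cast_natAbs, Int.cast_abs])
      have hlt : ∀ b : Bool, (if b = true then (pure false : Timed Bool) else pure true).cost = 0 := by
        intro b; cases b <;> rfl
      simp only [Timed.cost_bind, lt_cost, hlt]
      have h1 : ((1 + ((length L).cost + (R.cost + (m.cost + Q.cost))) : ℕ) : ℝ) ≤
          ((300 * L.length : ℕ) : ℝ) := by exact_mod_cast hbase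
      -- The bound by the number of edges of the hull is used for the logarithmic part of the cost,
      -- and the bound by n for the constant part per edge.
      have h2 : (H.length : ℝ) ≤ 2 * numEdges S := by exact_mod_cast hHe
      have h3 : (H.length : ℝ) ≤ L.length := by exact_mod_cast hHn
      have h4 : (2 : ℝ) ≤ L.length := by exact_mod_cast hlen2
      have h5 := mul_le_mul_of_nonneg_right h2 hlr
      push_cast at h1 ⊢
      nlinarith

end DigitalConvexity

theorem theoremt :
    ∃ C : ℝ, ∀ S : List (ℤ × ℤ), S.Nodup →
      ((DigitalConvexity.isDigitalConvex S).val = true ↔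
        DigitalConvexity.DigitalConvex {p | p ∈ S}) ∧
      (S ≠ [] →
        ((DigitalConvexity.isDigitalConvex S).cost : ℝ) ≤
          C * ((S.length : ℝ) +
            (DigitalConvexity.numEdges {p | p ∈ S} : ℝ) *
              Real.log (DigitalConvexity.diameter {p | p ∈ S}))) := by
  refine ⟨1000, fun S hS => ?_⟩
  match S, hS with
  | [], _ =>
    refine ⟨?_, fun h => absurd rfl h⟩
    simp only [DigitalConvexity.isDigitalConvex_nil, List.not_mem_nil, true_iff]
    exact DigitalConvexity.digitalConvex_empty
  | [p], _ =>
    obtain ⟨h1, h2⟩ := DigitalConvexity.isDigitalConvex_singleton p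
    have hset : {s | s ∈ [p]} = ({p} : Set (ℤ × ℤ)) := by ext; simp
    rw [hset]
    refine ⟨⟨fun _ => DigitalConvexity.digitalConvex_singleton p, fun _ => h1⟩, fun _ => ?_⟩
    have h3 : ((DigitalConvexity.isDigitalConvex [p]).cost : ℝ) ≤ 200 := by exact_mod_cast h2
    -- The diameter of a point is 0 and `Real.log 0 = 0`, so only the term n = 1 remains.
    simp [DigitalConvexity.diameter]
    linarith
  | p :: q :: l, hnd =>
    obtain ⟨h1, h2⟩ := DigitalConvexity.isDigitalConvex_spec hnd rfl
    exact ⟨h1, fun _ => h2⟩
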